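/- For a map $p\colon E\to B$ let $\mathrm{secat}(p)$ be the least $k\in\{0,1,\dots,\infty\}$ such that $B$ is covered by $k+1$ open sets over each of which $p$ has a continuous section. Put $\mathsf{TC}(X)=\mathrm{secat}\big(X^I\to X\times X,\ \alpha\mapsto(\alpha(0),\alpha(1))\big)$. For a path-connected space $Z$ with $\pi=\pi_1(Z,z_0)$, let $\mathsf{TC}^{\mathcal D}(Z)$ be the least $k\le\infty$ such that $Z\times Z$ is covered by $k+1$ open sets $U$ such that, for every basepoint $u\in U$, the image of $\pi_1(U,u)\to\pi_1(Z\times Z,u)\cong\pi\times\pi$ lies in a subgroup conjugate to the diagonal of $\pi\times\pi$. For a connected, locally path-connected space $Z$ with universal cover $P\colon\tilde Z\to Z$ and deck group $\pi=\pi_1(Z)$, let $\tilde Z\times_\pi\tilde Z$ be the quotient of $\tilde Z\times\tilde Z$ by the diagonal action of $\pi$. Let $q\colon \tilde Z\times_\pi\tilde Z\to Z\times Z$ be $q[x,y]=(Px,Py)$, and let $p\colon Z^I\to\tilde Z\times_\pi\tilde Z$ be $p(\gamma)=[\tilde\gamma(0),\tilde\gamma(1)]$, where $\tilde\gamma$ is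 any lift of $\gamma$. Let $\widetilde{\mathsf{TC}}(Z)$ be the least $k\le\infty$ such that $Z\times Z$ is covered by $k+1$ open sets $U$ for which $p$ has a continuous section over $q^{-1}(U)$. **Proposition.** Let $X$ be an aspherical CW complex (path-connected, $\pi_n(X)=0$ for all $n\ge2$, i.e. $X=K(\pi,1)$), let $Y$ be a simply connected space, and let $Z=X\times Y$ with the product topology. Then $$\mathsf{TC}^{\mathcal D}(Z)=\mathsf{TC}(X).$$ If moreover $Y$ is locally path-connected (so that $Z$ has a universal cover), then $$\widetilde{\mathsf{TC}}(Z)=\mathsf{TC}(Y),$$ whichever universal cover of $Z$ is used. In this case $$\mathsf{TC}^{\mathcal D}(Z)+\widetilde{\mathsf{TC}}(Z)=\mathsf{TC}(X)+\mathsf{TC}(Y),$$ and if $Z\times Z$ is a normal space, then the inequality $\mathsf{TC}(Z)\le\mathsf{TC}^{\mathcal D}(Z)+\widetilde{\mathsf{TC}}(Z)$ holds, and it reads as the product inequality $\mathsf{TC}(Z)\le\mathsf{TC}(X)+\mathsf{TC}(Y)$. -/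

import Mathlib

open scoped unitInterval Topology

namespace TopComplexity

/-! ### Sectional category and topological complexity -/

/-- The least `k` such that `B` is covered by `k + 1` open sets all having property `A`
(it is `⊤` if there is no such `k`). -/
noncomputable def minCover (B : Type*) [TopologicalSpace B] (A : Set B → Prop) : ℕ∞ :=
  ⨅ (k : ℕ) (_ : ∃ U : Fin (k + 1) → Set B,
    (∀ i, IsOpen (U i)) ∧ (⋃ i, U i) = Set.univ ∧ ∀ i, A (U i)), (k : ℕ∞)

/-- The map `p : E → B` has a continuous section over `U ⊆ B`. -/
def HasSectionOver {E B : Type*} [TopologicalSpace E] [TopologicalSpace B] (p : E → B)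
    (U : Set B) : Prop :=
  ∃ s : C(U, E), ∀ b : U, p (s b) = b

/-- The sectional category `secat(p)`. -/
noncomputable def secat {E B : Type*} [TopologicalSpace E] [TopologicalSpace B] (p : E → B) : ℕ∞ :=
  minCover B (HasSectionOver p)

/-- The free path fibration `X^I → X × X`, `α ↦ (α(0), α(1))`. -/
def pathFibration (X : Type*) [TopologicalSpace X] (α : C(I, X)) : X × X := (α 0, α 1)

/-- The (normalised) topological complexity `TC(X)`. -/
noncomputable def TC (X : Type*) [TopologicalSpace X] : ℕ∞ := secat (pathFibration X)

/-! ### The `D`-topological complexity -/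

section TCD

variable {X : Type*} [TopologicalSpace X]

/-- The diagonal subgroup `Δ` of `π₁(X × X, (x₀, x₀)) = π × π`: the image of
`π = π₁(X, x₀)` under the homomorphism induced by the diagonal map of `X`. -/
noncomputable def diagonalSubgroup (x₀ : X) : Subgroup (FundamentalGroup (X × X) (x₀, x₀)) :=
  (FundamentalGroup.map (⟨fun x => (x, x), by fun_prop⟩ : C(X, X × X)) x₀).range

/-- For every choice of basepoint `u ∈ U`, the homomorphism `π₁(U, u) → π₁(X × X, u)` induced by
the inclusion takes values in a subgroup conjugate to the diagonal `Δ`; here `π₁(X × X, u)` is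
identified with `π₁(X × X, (x₀, x₀))` along any path `δ` from `u` to `(x₀, x₀)`, and another path
changes the identification by a conjugation. -/
def IsDiagonalOn (x₀ : X) (U : Set (X × X)) : Prop :=
  ∀ (u : U) (δ : Path (u : X × X) (x₀, x₀)),
    ∃ g : FundamentalGroup (X × X) (x₀, x₀), ∀ a : FundamentalGroup U u,
      FundamentalGroup.fundamentalGroupMulEquivOfPath δ
          (FundamentalGroup.map (⟨Subtype.val, continuous_subtype_val⟩ : C(U, X × X)) u a)
        ∈ (diagonalSubgroup x₀).map (MulAut.conj g).toMonoidHom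

/-- The `D`-topological complexity `TC^D(X)` of a path-connected space `X`, with basepoint `x₀`. -/
noncomputable def TCD (x₀ : X) : ℕ∞ := minCover (X × X) (IsDiagonalOn x₀)

end TCD

/-! ### The invariant `T̃C` -/

/-- The invariant `s̃ecat(E → B' → B)` for maps `p : E → B'` and `q : B' → B`. -/
noncomputable def secatTilde {E B' B : Type*} [TopologicalSpace E] [TopologicalSpace B']
    [TopologicalSpace B] (p : E → B') (q : B' → B) : ℕ∞ :=
  minCover B (fun U => HasSectionOver p (q ⁻¹' U))

section Cover

variable {E Z : Type*} [TopologicalSpace E] [TopologicalSpace Z]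

/-- `P : E → Z` is a universal covering: a surjective covering map with simply connected total
space. -/
structure IsUniversalCover (P : E → Z) : Prop where
  isCoveringMap : IsCoveringMap P
  surjective : Function.Surjective P
  simplyConnected : SimplyConnectedSpace E

/-- The group of deck transformations of `P`. When `P` is the universal cover of a connected,
locally path-connected space this is the group `π = π₁(Z)` acting on `E` in the usual way. -/
def deckGroup (P : E → Z) : Subgroup (E ≃ₜ E) where
  carrier := {g | ∀ e, P (g e) = P e}
  mul_mem' := fun {a b} ha hb e => (ha (b e)).trans (hb e)
  one_mem' := fun _ => rfl
  inv_mem' := fun {a} ha e => by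
    have h := ha (a.symm e)
    rw [Homeomorph.apply_symm_apply] at h
    exact h.symm

/-- The orbit relation of the diagonal action of the deck group on `E × E`. -/
def diagonalOrbit (P : E → Z) : Setoid (E × E) where
  r a b := ∃ g ∈ deckGroup P, (g a.1, g a.2) = b
  iseqv :=
    { refl := fun a => ⟨1, (deckGroup P).one_mem, rfl⟩
      symm := by
        rintro a b ⟨g, hg, rfl⟩
        exact ⟨g⁻¹, (deckGroup P).inv_mem hg,
          Prod.ext (g.symm_apply_apply a.1) (g.symm_apply_apply a.2)⟩
      trans := by
        rintro a b c ⟨g, hg, rfl⟩ ⟨h, hh, rfl⟩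
        exact ⟨h * g, (deckGroup P).mul_mem hh hg, rfl⟩ }

/-- The space `E ×_π E`: the quotient of `E × E` by the diagonal action of the deck group, with
the quotient topology. -/
abbrev BalancedProduct (P : E → Z) : Type _ := Quotient (diagonalOrbit P)

/-- The covering `q : E ×_π E → Z × Z`, `[x, y] ↦ (P x, P y)`. -/
def balancedProj (P : E → Z) : BalancedProduct P → Z × Z :=
  Quotient.lift (fun a : E × E => (P a.1, P a.2)) (by
    rintro a b ⟨g, hg, rfl⟩
    exact Prod.ext (hg a.1).symm (hg a.2).symm)

/-- The fibration `p : Z^I → E ×_π E`, `γ ↦ [γ̃(0), γ̃(1)]`, for a lift `γ̃` of `γ` through `P`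
(the lift starting at some chosen point over `γ(0)`; the choice does not matter, see
`liftProj_eq`). -/
noncomputable def liftProj {P : E → Z} (hP : IsUniversalCover P) (γ : C(I, Z)) :
    BalancedProduct P :=
  let γ' : C(I, E) := hP.isCoveringMap.liftPath γ (hP.surjective (γ 0)).choose
    (hP.surjective (γ 0)).choose_spec.symm
  Quotient.mk (diagonalOrbit P) (γ' 0, γ' 1)

/-- Deck transformations of a universal cover act transitively on fibres. -/
theorem exists_deck [LocallyPathConnectedSpace Z] {P : E → Z} (hP : IsUniversalCover P)
    {e e' : E} (h : P e = P e') : ∃ g ∈ deckGroup P, g e = e' := by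
  have := hP.simplyConnected
  have : LocallyPathConnectedSpace E := by
    choose φ hφ hφP using hP.isCoveringMap.isLocalHomeomorph
    let _ : ChartedSpace Z E :=
      { atlas := Set.range φ
        chartAt := φ
        mem_chart_source := hφ
        chart_mem_atlas := Set.mem_range_self }
    exact ChartedSpace.locallyPathConnectedSpace Z E
  let f : C(E, Z) := ⟨P, hP.isCoveringMap.continuous⟩
  obtain ⟨F, ⟨hF, hPF⟩, -⟩ :=
    hP.isCoveringMap.existsUnique_continuousMap_lifts f e e' h.symm
  obtain ⟨G, ⟨hG, hPG⟩, -⟩ :=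
    hP.isCoveringMap.existsUnique_continuousMap_lifts f e' e h
  have hFG : ∀ x, F (G x) = x := congrFun (hP.isCoveringMap.eq_of_comp_eq
    (F.continuous.comp G.continuous) continuous_id
    (funext fun x => (congrFun hPF (G x)).trans (congrFun hPG x)) e' (by simp [hG, hF]))
  have hGF : ∀ x, G (F x) = x := congrFun (hP.isCoveringMap.eq_of_comp_eq
    (G.continuous.comp F.continuous) continuous_id
    (funext fun x => (congrFun hPG (F x)).trans (congrFun hPF x)) e (by simp [hG, hF]))
  exact ⟨⟨⟨F, G, hGF, hFG⟩, F.continuous, G.continuous⟩, fun x => congrFun hPF x, hF⟩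

/-- `p(γ) = [γ̃(0), γ̃(1)]` for every lift `γ̃` of `γ`. -/
theorem liftProj_eq [LocallyPathConnectedSpace Z] {P : E → Z} (hP : IsUniversalCover P)
    (γ : C(I, Z)) (Γ : C(I, E)) (hΓ : ∀ t, P (Γ t) = γ t) :
    liftProj hP γ = Quotient.mk (diagonalOrbit P) (Γ 0, Γ 1) := by
  have hs := (hP.surjective (γ 0)).choose_spec
  obtain ⟨g, hg, hge⟩ := exists_deck hP (hs.trans (hΓ 0).symm)
  have hL := hP.isCoveringMap.liftPath_lifts γ _ hs.symm
  have h0 := hP.isCoveringMap.liftPath_zero γ _ hs.symm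
  have key : ∀ t, g (hP.isCoveringMap.liftPath γ _ hs.symm t) = Γ t :=
    congrFun (hP.isCoveringMap.eq_of_comp_eq (g.continuous.comp (ContinuousMap.continuous _))
      Γ.continuous (funext fun t => by
        simpa [hΓ t] using (hg _).trans (congrFun hL t)) 0 (by simpa [h0] using hge))
  exact Quotient.sound ⟨g, hg, Prod.ext (key 0) (key 1)⟩

/-- The invariant `T̃C(Z) = s̃ecat(Z^I → E ×_π E → Z × Z)`, where `P : E → Z` is the universal
cover of `Z`. -/
noncomputable def TCTilde {P : E → Z} (hP : IsUniversalCover P) : ℕ∞ :=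
  secatTilde (liftProj hP) (balancedProj P)

end Cover

/-! ### Aspherical spaces -/

/-- `X` is aspherical, i.e. a `K(π, 1)` with `π = π₁(X)`: it is path-connected and `πₙ(X, x) = 0`
for all `n ≥ 2`. -/
structure IsAspherical (X : Type*) [TopologicalSpace X] : Prop where
  pathConnected : PathConnectedSpace X
  subsingleton_pi : ∀ n : ℕ, 2 ≤ n → ∀ x : X, Subsingleton (π_ n X x)

end TopComplexity

/-! The heart of the matter is that the universal cover `E'` of an aspherical CW complex `X` is
contractible (`exists_contracting_paths`), so any two points of `E'` can be joined by a path
depending continuously on them. This choice is not equivariant. Over a set where `E' → X` has a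
section, however, each pair in the balanced product has a unique representative whose first entry
lies on that section, and the choice descends. Over such sets `liftProj` is shrinkable, so Dold's
gluing `exists_section_of_shrinkable` gives a global section `s` of it (`exists_section_liftProj`).
The functions needed for the gluing are built radially on the cells (`tau`, `sigma`).

Composition with `s` turns a section of `q` over an open `U ⊆ X × X` into a section of the path
fibration over `U`. The diagonal condition on `U` provides a section of `q`
(`IsConjugateOn.exists_balanced`), and a section of the path fibration gives the condition back
(`isConjugateOn_of_section`). As `Y` contributes nothing to `π₁`, covers pass between `X` and `X ×
Y` along the projection and a slice, whence the first equality.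

For the second equality, a slice `{x} × Y` lifts to the universal cover of `X × Y`, so a section of
`liftProj` restricts to a motion planner on `Y` (`le_TCTilde_prod`). Conversely, `s` supplies the
`X`-coordinate of a path globally and a planner on `Y` supplies the other coordinate; the resulting
path lifts with the prescribed end points because the cover of `X × Y` injects into `E' × Y`
(`map_cover_injective`, `TCTilde_prod_le`). The product inequality is the classical one, with
normality providing partitions of unity for `minCover_le_add`. -/

open scoped unitInterval Topology

namespace TopComplexity

/-! ### Open covers with a prescribed property -/

section MinCover

variable {B B' : Type*} [TopologicalSpace B] [TopologicalSpace B'] {A A₁ A₂ : Set B → Prop}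

theorem minCover_le {k : ℕ} (U : Fin (k + 1) → Set B) (hU : ∀ i, IsOpen (U i))
    (hc : (⋃ i, U i) = Set.univ) (hA : ∀ i, A (U i)) : minCover B A ≤ k :=
  iInf₂_le k ⟨U, hU, hc, hA⟩

theorem minCover_eq_top_or_exists (B : Type*) [TopologicalSpace B] (A : Set B → Prop) :
    minCover B A = ⊤ ∨ ∃ k : ℕ, minCover B A = k ∧ ∃ U : Fin (k + 1) → Set B,
      (∀ i, IsOpen (U i)) ∧ (⋃ i, U i) = Set.univ ∧ ∀ i, A (U i) := by
  classical
  by_cases h : ∃ k : ℕ, ∃ U : Fin (k + 1) → Set B,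
      (∀ i, IsOpen (U i)) ∧ (⋃ i, U i) = Set.univ ∧ ∀ i, A (U i)
  · refine Or.inr ⟨Nat.find h, le_antisymm ?_ ?_, Nat.find_spec h⟩
    · exact iInf₂_le (f := fun (k : ℕ) _ => (k : ℕ∞)) _ (Nat.find_spec h)
    exact le_iInf₂ fun k hk => by exact_mod_cast Nat.find_min' h hk
  · push Not at h
    left
    refine iInf₂_eq_top.2 fun k ⟨U, h1, h2, h3⟩ => ?_
    obtain ⟨i, hi⟩ := h k U h1 h2
    exact absurd (h3 i) hi

/-- Pulling back covers along a continuous map. -/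
theorem minCover_le_of_preimage {A' : Set B' → Prop} {f : B → B'} (hf : Continuous f)
    (h : ∀ U, IsOpen U → A' U → A (f ⁻¹' U)) : minCover B A ≤ minCover B' A' := by
  refine le_iInf₂ fun k ⟨U, h1, h2, h3⟩ => ?_
  refine minCover_le (fun i => f ⁻¹' U i) (fun i => (h1 i).preimage hf) ?_
    fun i => h _ (h1 i) (h3 i)
  rw [← Set.preimage_iUnion, h2, Set.preimage_univ]

/-- The usual product argument: from covers of sizes `n + 1` and `m + 1`, partitions of unity
produce `n + m + 1` open sets, each a disjoint union of open pieces lying in some `U i ∩ V j`. The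
two hypotheses say that the property passes to such pieces and to such unions. -/
theorem minCover_le_add [NormalSpace B]
    (hinter : ∀ U V W, IsOpen W → W ⊆ U → W ⊆ V → A₁ U → A₂ V → A W)
    (hunion : ∀ (κ : Type) (W : κ → Set B), (∀ i, IsOpen (W i)) →
      (∀ i j, (W i ∩ W j).Nonempty → i = j) → (∀ i, A (W i)) → A (⋃ i, W i)) :
    minCover B A ≤ minCover B A₁ + minCover B A₂ := by
  classical
  rcases minCover_eq_top_or_exists B A₁ with h | ⟨n, hn, U, hU, hUc, hUA⟩
  · simp [h]
  rcases minCover_eq_top_or_exists B A₂ with h | ⟨m, hm, V, hV, hVc, hVA⟩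
  · simp [h]
  rw [hn, hm]
  obtain ⟨f, hf⟩ := PartitionOfUnity.exists_isSubordinate_of_locallyFinite isClosed_univ U hU
    (locallyFinite_of_finite U) hUc.ge
  obtain ⟨g, hg⟩ := PartitionOfUnity.exists_isSubordinate_of_locallyFinite isClosed_univ V hV
    (locallyFinite_of_finite V) hVc.ge
  let ST := Finset (Fin (n + 1)) × Finset (Fin (m + 1))
  -- On `W (S, T)` every product `f i * g j` indexed by the rectangle `S × T` is positive and
  -- strictly exceeds every product indexed outside it.
  let W : ST → Set B := fun P => {b | ∀ i ∈ P.1, ∀ j ∈ P.2, 0 < f i b * g j b ∧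
    ∀ i' j', ¬ (i' ∈ P.1 ∧ j' ∈ P.2) → f i' b * g j' b < f i b * g j b}
  have hWo : ∀ P, IsOpen (W P) := by
    intro P
    simp only [W, Set.ofPred_forall, Set.ofPred_and]
    refine isOpen_iInter_of_finite fun i => isOpen_iInter_of_finite fun _ =>
      isOpen_iInter_of_finite fun j => isOpen_iInter_of_finite fun _ => IsOpen.inter ?_ ?_
    · exact isOpen_lt continuous_const (by fun_prop)
    · refine isOpen_iInter_of_finite fun i' => isOpen_iInter_of_finite fun j' =>
        isOpen_iInter_of_finite fun _ => isOpen_lt (by fun_prop) (by fun_prop)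
  have hWA : ∀ P : ST, P.1.Nonempty → P.2.Nonempty → A (W P) := by
    rintro P ⟨i, hi⟩ ⟨j, hj⟩
    have hpos : ∀ b ∈ W P, f i b ≠ 0 ∧ g j b ≠ 0 := fun b hb =>
      mul_ne_zero_iff.1 (hb i hi j hj).1.ne'
    refine hinter (U i) (V j) _ (hWo P) (fun b hb => ?_) (fun b hb => ?_) (hUA i) (hVA j)
    · exact hf i (subset_tsupport _ (hpos b hb).1)
    · exact hg j (subset_tsupport _ (hpos b hb).2)
  -- For nonempty `S` and `T` the sum of the cardinalities runs from `2` to `n + m + 2`, which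
  -- leaves `n + m + 1` classes.
  let κ : ℕ → Type := fun k => {P : ST // P.1.Nonempty ∧ P.2.Nonempty ∧ P.1.card + P.2.card = k + 2}
  have key : ∀ k, ∀ P Q : κ k, (W P.1 ∩ W Q.1).Nonempty → P.1.1 ⊆ Q.1.1 ∧ P.1.2 ⊆ Q.1.2 := by
    rintro k ⟨⟨S, T⟩, ⟨s, hs⟩, ⟨t, ht⟩, hP⟩ ⟨⟨S', T'⟩, ⟨s', hs'⟩, ⟨t', ht'⟩, hQ⟩ ⟨b, hb, hb'⟩
    replace hP : S.card + T.card = k + 2 := hP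
    replace hQ : S'.card + T'.card = k + 2 := hQ
    -- Distinct rectangles in one class do not contain one another. Each then has an index pair
    -- outside the other, and at a common point the two strict inequalities contradict each other.
    by_contra hcon
    have h1 : ∃ i ∈ S, ∃ j ∈ T, ¬ (i ∈ S' ∧ j ∈ T') := by
      by_contra h
      push Not at h
      exact hcon ⟨fun i hi => (h i hi t ht).1, fun j hj => (h s hs j hj).2⟩
    have h2 : ∃ i ∈ S', ∃ j ∈ T', ¬ (i ∈ S ∧ j ∈ T) := by
      by_contra h
      push Not at h
      have e1 : S' ⊆ S := fun i hi => (h i hi t' ht').1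
      have e2 : T' ⊆ T := fun j hj => (h s' hs' j hj).2
      have c1 := Finset.card_le_card e1
      have c2 := Finset.card_le_card e2
      have := Finset.eq_of_subset_of_card_le e1 (by omega)
      have := Finset.eq_of_subset_of_card_le e2 (by omega)
      subst_vars
      exact hcon ⟨subset_rfl, subset_rfl⟩
    obtain ⟨i, hi, j, hj, hij⟩ := h1
    obtain ⟨i', hi', j', hj', hij'⟩ := h2
    exact lt_asymm ((hb i hi j hj).2 i' j' hij') ((hb' i' hi' j' hj').2 i j hij)
  have hle := minCover_le (A := A) (k := n + m) (fun k => ⋃ P : κ k, W P.1)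
    (fun k => isOpen_iUnion fun P => hWo P.1) ?_ ?_
  · exact_mod_cast hle
  · refine Set.eq_univ_of_forall fun b => ?_
    obtain ⟨i₀, -, hi₀⟩ := Finset.exists_max_image Finset.univ (fun i => f i b) Finset.univ_nonempty
    obtain ⟨j₀, -, hj₀⟩ := Finset.exists_max_image Finset.univ (fun j => g j b) Finset.univ_nonempty
    have fpos : 0 < f i₀ b := by
      obtain ⟨i, hi⟩ := f.exists_pos (Set.mem_univ b)
      exact hi.trans_le (hi₀ i (Finset.mem_univ _))
    have gpos : 0 < g j₀ b := by
      obtain ⟨i, hi⟩ := g.exists_pos (Set.mem_univ b)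
      exact hi.trans_le (hj₀ i (Finset.mem_univ _))
    -- The indices attaining the two maxima form a rectangle whose set `W` contains `b`.
    let S : Finset (Fin (n + 1)) := {i | f i b = f i₀ b}
    let T : Finset (Fin (m + 1)) := {j | g j b = g j₀ b}
    have hS : S.Nonempty := ⟨i₀, by simp [S]⟩
    have hT : T.Nonempty := ⟨j₀, by simp [T]⟩
    have c1 := hS.card_pos
    have c2 := hT.card_pos
    have c3 := S.card_le_univ
    have c4 := T.card_le_univ
    rw [Fintype.card_fin] at c3 c4
    refine Set.mem_iUnion.2 ⟨⟨S.card + T.card - 2, by omega⟩, Set.mem_iUnion.2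
      ⟨⟨(S, T), hS, hT, by simp only; omega⟩, ?_⟩⟩
    intro i hi j hj
    have hi : f i b = f i₀ b := by simpa [S] using hi
    have hj : g j b = g j₀ b := by simpa [T] using hj
    rw [hi, hj]
    refine ⟨mul_pos fpos gpos, fun i' j' h => ?_⟩
    have l1 := hi₀ i' (Finset.mem_univ _)
    have l2 := hj₀ j' (Finset.mem_univ _)
    by_cases h' : f i' b = f i₀ b
    · have h'' : g j' b ≠ g j₀ b := fun h'' => h ⟨by simpa [S] using h', by simpa [T] using h''⟩
      rw [h']
      exact mul_lt_mul_of_pos_left (lt_of_le_of_ne l2 h'') fpos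
    · calc f i' b * g j' b ≤ f i' b * g j₀ b := mul_le_mul_of_nonneg_left l2 (f.nonneg _ _)
        _ < f i₀ b * g j₀ b := mul_lt_mul_of_pos_right (lt_of_le_of_ne l1 h') gpos
  · intro k
    refine hunion (κ k) (fun P => W P.1) (fun P => hWo _) (fun P Q h => ?_)
      fun P => hWA _ P.2.1 P.2.2.1
    have h1 := key k P Q h
    have h2 := key k Q P (by rwa [Set.inter_comm])
    exact Subtype.ext (Prod.ext (h1.1.antisymm h2.1) (h1.2.antisymm h2.2))

end MinCover

/-! ### Gluing local sections -/

section Sections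

variable {E B : Type*} [TopologicalSpace E] [TopologicalSpace B] {p : E → B}

theorem HasSectionOver.of_continuousOn {U : Set B} {s : B → E} (hs : ContinuousOn s U)
    (hp : ∀ b ∈ U, p (s b) = b) : HasSectionOver p U :=
  ⟨⟨U.domRestrict s, hs.domRestrict⟩, fun b => hp b b.2⟩

theorem HasSectionOver.exists_continuousOn [Nonempty E] {U : Set B} (h : HasSectionOver p U) :
    ∃ s : B → E, ContinuousOn s U ∧ ∀ b ∈ U, p (s b) = b := by
  classical
  obtain ⟨s, hs⟩ := h
  have e : ∀ b : U, (fun b => if h : b ∈ U then s ⟨b, h⟩ else Classical.arbitrary E) b.1 = s b :=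
    fun b => by simp
  refine ⟨fun b => if h : b ∈ U then s ⟨b, h⟩ else Classical.arbitrary E, ?_, fun b hb => ?_⟩
  · rw [continuousOn_iff_continuous_domRestrict]
    exact s.continuous.congr fun b => (e b).symm
  · exact (congrArg p (e ⟨b, hb⟩)).trans (hs ⟨b, hb⟩)

theorem exists_continuousOn_iUnion {κ : Type*} [Nonempty E] {W : κ → Set B}
    (hW : ∀ i, IsOpen (W i)) (hd : ∀ i j, (W i ∩ W j).Nonempty → i = j) {s : κ → B → E}
    (hs : ∀ i, ContinuousOn (s i) (W i)) :
    ∃ t : B → E, ContinuousOn t (⋃ i, W i) ∧ ∀ i, Set.EqOn t (s i) (W i) := by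
  classical
  let t : B → E := fun b => if h : ∃ i, b ∈ W i then s h.choose b else Classical.arbitrary E
  have ht : ∀ i, Set.EqOn t (s i) (W i) := by
    intro i b hb
    have h : ∃ i, b ∈ W i := ⟨i, hb⟩
    have : h.choose = i := hd _ _ ⟨b, h.choose_spec, hb⟩
    simp only [t, dif_pos h, this]
  refine ⟨t, fun b hb => ?_, ht⟩
  obtain ⟨i, hi⟩ := Set.mem_iUnion.1 hb
  have h1 : ContinuousAt (s i) b := (hs i).continuousAt ((hW i).mem_nhds hi)
  refine (h1.congr ?_).continuousWithinAt
  filter_upwards [(hW i).mem_nhds hi] with c hc using (ht i hc).symm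

theorem HasSectionOver.iUnion [Nonempty E] {κ : Type*} {W : κ → Set B}
    (hW : ∀ i, IsOpen (W i)) (hd : ∀ i j, (W i ∩ W j).Nonempty → i = j)
    (h : ∀ i, HasSectionOver p (W i)) : HasSectionOver p (⋃ i, W i) := by
  choose s hs hps using fun i => (h i).exists_continuousOn
  obtain ⟨t, ht, hts⟩ := exists_continuousOn_iUnion hW hd hs
  refine .of_continuousOn ht fun b hb => ?_
  obtain ⟨i, hi⟩ := Set.mem_iUnion.1 hb
  rw [hts i hi, hps i b hi]

end Sections

/-- **Dold's gluing of sections.** A map which is shrinkable over the cozero sets of a countable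
locally finite family of functions without common zeros has a global section. -/
theorem exists_section_of_shrinkable {E B : Type*} [TopologicalSpace E] [TopologicalSpace B]
    {p : E → B} (τ : ℕ → B → ℝ) (hτ : ∀ n, Continuous (τ n)) (hτ0 : ∀ n b, 0 ≤ τ n b)
    (hcov : ∀ b, ∃ n, 0 < τ n b) (hfin : ∀ b, ∃ N, ∀ᶠ c in 𝓝 b, ∀ n, N ≤ n → τ n c = 0)
    (t : ℕ → B → E) (ht : ∀ n, ContinuousOn (t n) {b | 0 < τ n b})
    (hpt : ∀ n b, 0 < τ n b → p (t n b) = b)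
    (h : ℕ → E × ℝ → E) (hh : ∀ n, ContinuousOn (h n) {x | 0 < τ n (p x.1)})
    (hph : ∀ n e r, 0 < τ n (p e) → p (h n (e, r)) = p e)
    (hh0 : ∀ n e r, 0 < τ n (p e) → r ≤ 0 → h n (e, r) = e)
    (hh1 : ∀ n e r, 0 < τ n (p e) → 1 ≤ r → h n (e, r) = t n (p e)) :
    ∃ s : B → E, Continuous s ∧ ∀ b, p (s b) = b := by
  classical
  let l : ℕ → B → ℝ := fun n b => ∑ i ∈ Finset.range n, τ i b
  have hl : ∀ n, Continuous (l n) := fun n => continuous_finsetSum _ fun i _ => hτ i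
  have hl0 : ∀ n b, 0 ≤ l n b := fun n b => Finset.sum_nonneg fun i _ => hτ0 i b
  have hls : ∀ n b, l (n + 1) b = l n b + τ n b := fun n b => Finset.sum_range_succ _ _
  -- `s n` is a section over `{l n > 0}`; its start `t 0` is irrelevant, since `l 0 = 0`. On the
  -- overlap with `{τ n > 0}` it is deformed towards `t n`, with parameter `3ρ - 1` for `ρ = τ n / l
  -- (n + 1)`. Thus it is still the old section where `ρ ≤ 1/3` and already `t n` where `ρ ≥ 2/3`,
  -- which gives continuity at both ends of the overlap.
  let s : ℕ → B → E := fun n => Nat.rec (t 0) (fun n sn b =>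
    if τ n b = 0 then sn b else if l n b = 0 then t n b
      else h n (sn b, 3 * (τ n b / l (n + 1) b) - 1)) n
  have hs : ∀ n b, s (n + 1) b = if τ n b = 0 then s n b else if l n b = 0 then t n b
      else h n (s n b, 3 * (τ n b / l (n + 1) b) - 1) := fun n b => rfl
  have hps : ∀ n b, 0 < l n b → p (s n b) = b := by
    intro n
    induction n with
    | zero => intro b hb; simp [l] at hb
    | succ n ih =>
      intro b hb
      rw [hs]
      split_ifs with h1 h2
      · exact ih b (by rw [hls, h1, add_zero] at hb; exact hb)
      · exact hpt n b (lt_of_le_of_ne (hτ0 n b) (Ne.symm h1))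
      · have e := ih b (lt_of_le_of_ne (hl0 n b) (Ne.symm h2))
        rw [hph, e]
        rw [e]
        exact lt_of_le_of_ne (hτ0 n b) (Ne.symm h1)
  have hcs : ∀ n, ContinuousOn (s n) {b | 0 < l n b} := by
    intro n
    induction n with
    | zero => intro b hb; simp [l] at hb
    | succ n ih =>
      intro b hb
      have hb : 0 < l (n + 1) b := hb
      apply ContinuousAt.continuousWithinAt
      have hrat : ContinuousAt (fun c => τ n c / l (n + 1) c) b :=
        (hτ n).continuousAt.div (hl _).continuousAt hb.ne'
      by_cases h1 : τ n b = 0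
      · have hln : 0 < l n b := by rw [hls, h1, add_zero] at hb; exact hb
        have c1 : ContinuousAt (s n) b :=
          ih.continuousAt ((isOpen_lt continuous_const (hl n)).mem_nhds hln)
        refine c1.congr ?_
        have hr0 : ∀ᶠ c in 𝓝 b, τ n c / l (n + 1) c < 1 / 3 :=
          hrat.eventually (gt_mem_nhds (by simp [h1]))
        filter_upwards [hr0, (isOpen_lt continuous_const (hl n)).mem_nhds hln] with c h3 h4
        have h4 : 0 < l n c := h4
        rw [hs]
        split_ifs with h5 h6
        · rfl
        · exact absurd h6 h4.ne'
        · rw [hh0 n _ _ (by rw [hps n c h4]; exact lt_of_le_of_ne (hτ0 n c) (Ne.symm h5))]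
          linarith
      have h1' : 0 < τ n b := lt_of_le_of_ne (hτ0 n b) (Ne.symm h1)
      have hτn := (isOpen_lt continuous_const (hτ n)).mem_nhds h1'
      by_cases h2 : l n b = 0
      · have c1 : ContinuousAt (t n) b := (ht n).continuousAt hτn
        refine c1.congr ?_
        have hr0 : ∀ᶠ c in 𝓝 b, 2 / 3 < τ n c / l (n + 1) c :=
          hrat.eventually (lt_mem_nhds (by simp only [hls]; rw [ h2, zero_add, div_self h1]; norm_num))
        filter_upwards [hr0, hτn] with c h3 h4
        have h4 : 0 < τ n c := h4
        rw [hs, if_neg h4.ne']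
        split_ifs with h5
        · rfl
        · have e := hps n c (lt_of_le_of_ne (hl0 n c) (Ne.symm h5))
          rw [hh1 n _ _ (by rw [e]; exact h4) (by linarith), e]
      · have h2' : 0 < l n b := lt_of_le_of_ne (hl0 n b) (Ne.symm h2)
        have hln := (isOpen_lt continuous_const (hl n)).mem_nhds h2'
        have hW : {b | 0 < τ n b} ∩ {b | 0 < l n b} ∈ 𝓝 b := Filter.inter_mem hτn hln
        have c1 : ContinuousOn (fun c => h n (s n c, 3 * (τ n c / l (n + 1) c) - 1))
            ({b | 0 < τ n b} ∩ {b | 0 < l n b}) := by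
          refine (hh n).comp (ContinuousOn.prodMk (ih.mono Set.inter_subset_right) ?_) ?_
          · refine ContinuousOn.sub (continuousOn_const.mul ((hτ n).continuousOn.div
              (hl _).continuousOn fun c hc => ?_)) continuousOn_const
            rw [hls]
            exact (add_pos hc.2 hc.1).ne'
          · intro c hc
            simp only [Set.mem_ofPred_eq]
            rw [hps n c hc.2]
            exact hc.1
        refine (c1.continuousAt hW).congr ?_
        filter_upwards [hW] with c hc
        rw [hs, if_neg (ne_of_gt hc.1), if_neg (ne_of_gt hc.2)]
  -- A vanishing `τ n` leaves the section unchanged, so by local finiteness the sequence is locally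
  -- stationary.
  have hstab : ∀ b N, (∀ n, N ≤ n → τ n b = 0) → ∀ n, N ≤ n → s n b = s N b := by
    intro b N hN n hn
    induction n, hn using Nat.le_induction with
    | base => rfl
    | succ n hn ih => rw [hs, if_pos (hN n hn), ih]
  have hlpos : ∀ b N, (∀ n, N ≤ n → τ n b = 0) → 0 < l N b := by
    intro b N hN
    obtain ⟨n, hn⟩ := hcov b
    have : n < N := by
      by_contra h
      exact hn.ne' (hN n (not_lt.1 h))
    exact lt_of_lt_of_le hn (Finset.single_le_sum (fun i _ => hτ0 i b) (Finset.mem_range.2 this))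
  choose N hN using hfin
  refine ⟨fun b => s (N b) b, continuous_iff_continuousAt.2 fun b => ?_, fun b =>
    hps _ b (hlpos b _ (hN b).self_of_nhds)⟩
  have c1 : ContinuousAt (s (N b)) b := (hcs _).continuousAt
    ((isOpen_lt continuous_const (hl _)).mem_nhds (hlpos b _ (hN b).self_of_nhds))
  refine c1.congr ?_
  filter_upwards [hN b] with c hc
  rcases le_total (N b) (N c) with hle | hle
  · exact (hstab c _ hc _ hle).symm
  · exact hstab c _ (hN c).self_of_nhds _ hle

end TopComplexity

/-! ### Cell structures and cell-by-cell continuity -/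

namespace TopComplexity

/-- The radial retraction of `ℝⁿ` (with the sup norm) onto the closed unit ball. -/
noncomputable def clampBall {n : ℕ} (d : Fin n → ℝ) : Fin n → ℝ := (max 1 ‖d‖)⁻¹ • d

theorem continuous_clampBall {n : ℕ} : Continuous (clampBall (n := n)) := by
  unfold clampBall
  have h : ∀ d : Fin n → ℝ, max 1 ‖d‖ ≠ 0 := fun d => (lt_max_of_lt_left one_pos).ne'
  fun_prop (disch := exact h _)

theorem clampBall_of_le {n : ℕ} {d : Fin n → ℝ} (hd : ‖d‖ ≤ 1) : clampBall d = d := by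
  rw [clampBall, max_eq_left hd, inv_one, one_smul]

theorem norm_clampBall_le {n : ℕ} (d : Fin n → ℝ) : ‖clampBall d‖ ≤ 1 := by
  have h : 0 < max 1 ‖d‖ := lt_max_of_lt_left one_pos
  rw [clampBall, norm_smul, norm_inv, Real.norm_of_nonneg h.le, inv_mul_le_one₀ h]
  exact le_max_right _ _

/-- A decomposition of a space into open cells of finite dimension such that the space has the
weak topology with respect to the characteristic maps, and so do the skeleta as far as attaching
maps are concerned. The characteristic maps live on `ℝⁿ`, but only their values on the closed unit
ball (for the sup norm) matter. -/
structure CellStructure.{v, u} (X : Type u) [TopologicalSpace X] where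
  /-- The index type of the cells. -/
  ι : Type v
  /-- The dimension of a cell. -/
  dim : ι → ℕ
  /-- The characteristic map of a cell. -/
  Φ : ∀ i, C(Fin (dim i) → ℝ, X)
  Φ_clamp : ∀ i d, Φ i (clampBall d) = Φ i d
  existsUnique_pt : ∀ x, ∃! p : Σ i, (Fin (dim i) → ℝ), ‖p.2‖ < 1 ∧ Φ p.1 p.2 = x
  boundary : ∀ i d, ‖d‖ = 1 → ∃ j d', dim j < dim i ∧ ‖d'‖ < 1 ∧ Φ j d' = Φ i d
  isOpen_of : ∀ A : Set X, (∀ i, IsOpen (Φ i ⁻¹' A)) → IsOpen A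
  attach : ∀ (i) (A : Set X), (∀ j, dim j < dim i → IsOpen (Φ j ⁻¹' A)) → ∀ d, ‖d‖ = 1 → Φ i d ∈ A →
    ∀ᶠ d' in 𝓝[Metric.sphere 0 1] d, Φ i d' ∈ A

namespace CellStructure

section OfCWComplex

open Topology.CWComplex Topology.RelCWComplex in
/-- The cell structure of a CW complex. -/
noncomputable def ofCWComplex (X : Type*) [TopologicalSpace X] [T2Space X]
    [Topology.CWComplex (Set.univ : Set X)] : CellStructure X where
  ι := Σ n, cell (Set.univ : Set X) n
  dim i := i.1
  Φ i := ⟨fun d => map (C := (Set.univ : Set X)) i.1 i.2 (clampBall d),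
    (continuousOn i.1 i.2).comp_continuous continuous_clampBall
      fun d => mem_closedBall_zero_iff.2 (norm_clampBall_le d)⟩
  Φ_clamp i d := by
    simp only [ContinuousMap.coe_mk, clampBall_of_le (norm_clampBall_le d)]
  existsUnique_pt x := by
    have hx : x ∈ ⋃ (n : ℕ) (j : cell (Set.univ : Set X) n), openCell n j := by
      rw [Topology.CWComplex.iUnion_openCell_eq_complex]; trivial
    simp only [Set.mem_iUnion] at hx
    obtain ⟨n, j, d, hd, rfl⟩ := hx
    have hd1 : ‖d‖ < 1 := mem_ball_zero_iff.1 hd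
    refine ⟨⟨⟨n, j⟩, d⟩, ⟨hd1, by simp [clampBall_of_le hd1.le]⟩, ?_⟩
    rintro ⟨⟨m, k⟩, d'⟩ ⟨h1, h2⟩
    dsimp only at h1
    simp only [ContinuousMap.coe_mk, clampBall_of_le h1.le] at h2
    have e : (⟨m, k⟩ : Σ n, cell (Set.univ : Set X) n) = ⟨n, j⟩ := by
      refine Topology.CWComplex.eq_of_not_disjoint_openCell (Set.not_disjoint_iff.2 ⟨_,
        ⟨d', mem_ball_zero_iff.2 h1, h2⟩, ⟨d, hd, rfl⟩⟩)
    cases e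
    have := (map (C := (Set.univ : Set X)) n j).injOn
      (by rw [source_eq]; exact mem_ball_zero_iff.2 h1) (by rw [source_eq]; exact hd) h2
    rw [this]
  boundary i d hd := by
    obtain ⟨J, hJ⟩ := Topology.CWComplex.cellFrontier_subset_finite_openCell i.1 i.2
    have := hJ ⟨d, mem_sphere_zero_iff_norm.2 hd, rfl⟩
    simp only [Set.mem_iUnion] at this
    obtain ⟨m, hm, j, -, d', hd', e⟩ := this
    have h1 : ‖d'‖ < 1 := mem_ball_zero_iff.1 hd'
    exact ⟨⟨m, j⟩, d', hm, h1, by simp [clampBall_of_le h1.le, clampBall_of_le hd.le, e]⟩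
  isOpen_of A hA := by
    rw [← isClosed_compl_iff, Topology.CWComplex.closed (Set.univ : Set X) _ (Set.subset_univ _)]
    intro n j
    have h1 := (hA ⟨n, j⟩).isClosed_compl
    -- The trace of `Aᶜ` on a closed cell is the image of a compact set, hence closed because `X` is
    -- Hausdorff.
    have h2 : Aᶜ ∩ closedCell n j = (fun d => map (C := (Set.univ : Set X)) n j (clampBall d)) ''
        (((fun d => map (C := (Set.univ : Set X)) n j (clampBall d)) ⁻¹' A)ᶜ ∩
          Metric.closedBall 0 1) := by
      ext x
      constructor
      · rintro ⟨hx, d, hd, rfl⟩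
        have e : clampBall d = d := clampBall_of_le (mem_closedBall_zero_iff.1 hd)
        exact ⟨d, ⟨by simpa [e] using hx, hd⟩, by simp [e]⟩
      · rintro ⟨d, ⟨h1, h2⟩, rfl⟩
        exact ⟨h1, _, mem_closedBall_zero_iff.2 (norm_clampBall_le d), rfl⟩
    rw [h2]
    refine (((isCompact_closedBall _ _).inter_left h1).image ?_).isClosed
    exact (continuousOn n j).comp_continuous continuous_clampBall
      fun d => mem_closedBall_zero_iff.2 (norm_clampBall_le d)
  attach i A hA d hd hdA := by
    obtain ⟨J, hJ⟩ := Topology.CWComplex.cellFrontier_subset_finite_closedCell i.1 i.2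
    -- The frontier of the cell meets only finitely many lower closed cells. So the part of `Aᶜ`
    -- that matters there is a closed set `K`, although `A` itself need not be open in `X`.
    let K : Set X := ⋃ (m : Fin i.1) (j ∈ J m), (Aᶜ ∩ closedCell m.1 j)
    have hK : IsClosed K := by
      refine isClosed_iUnion_of_finite fun m => (J m).finite_toSet.isClosed_biUnion fun j _ => ?_
      have h1 := (hA ⟨m, j⟩ m.2).isClosed_compl
      have h2 : Aᶜ ∩ closedCell m.1 j =
          (fun d => map (C := (Set.univ : Set X)) m.1 j (clampBall d)) ''
          (((fun d => map (C := (Set.univ : Set X)) m.1 j (clampBall d)) ⁻¹' A)ᶜ ∩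
            Metric.closedBall 0 1) := by
        ext x
        constructor
        · rintro ⟨hx, d, hd, rfl⟩
          have e : clampBall d = d := clampBall_of_le (mem_closedBall_zero_iff.1 hd)
          exact ⟨d, ⟨by simpa [e] using hx, hd⟩, by simp [e]⟩
        · rintro ⟨d, ⟨h1, h2⟩, rfl⟩
          exact ⟨h1, _, mem_closedBall_zero_iff.2 (norm_clampBall_le d), rfl⟩
      rw [h2]
      refine (((isCompact_closedBall _ _).inter_left h1).image ?_).isClosed
      exact (continuousOn m.1 j).comp_continuous continuous_clampBall
        fun d => mem_closedBall_zero_iff.2 (norm_clampBall_le d)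
    have hc : Continuous fun d => map (C := (Set.univ : Set X)) i.1 i.2 (clampBall d) :=
      (continuousOn i.1 i.2).comp_continuous continuous_clampBall
        fun d => mem_closedBall_zero_iff.2 (norm_clampBall_le d)
    have hdK : map (C := (Set.univ : Set X)) i.1 i.2 (clampBall d) ∉ K := by
      simp only [K, Set.mem_iUnion, not_exists]
      rintro m j hj ⟨h1, -⟩
      exact h1 hdA
    have hev : ∀ᶠ d' in 𝓝[Metric.sphere (0 : Fin i.1 → ℝ) 1] d,
        map (C := (Set.univ : Set X)) i.1 i.2 (clampBall d') ∉ K :=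
      nhdsWithin_le_nhds ((hK.isOpen_compl.preimage hc).mem_nhds hdK)
    filter_upwards [hev, self_mem_nhdsWithin] with d' h1 h2
    have h3 := hJ ⟨d', h2, rfl⟩
    simp only [Set.mem_iUnion] at h3
    obtain ⟨m, hm, j, hj, h4⟩ := h3
    by_contra hcon
    have e : clampBall d' = d' := clampBall_of_le (mem_sphere_zero_iff_norm.1 h2).le
    refine h1 (Set.mem_iUnion.2 ⟨⟨m, hm⟩, Set.mem_iUnion₂.2 ⟨j, hj, hcon, ?_⟩⟩)
    rw [e]
    exact h4

end OfCWComplex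

variable {X : Type*} [TopologicalSpace X] (c : CellStructure X)

/-- The cell containing a point in its interior, and the coordinates of the point in that cell. -/
noncomputable def pt (x : X) : Σ i, (Fin (c.dim i) → ℝ) := (c.existsUnique_pt x).choose

theorem norm_pt_lt (x : X) : ‖(c.pt x).2‖ < 1 := (c.existsUnique_pt x).choose_spec.1.1

theorem Φ_pt (x : X) : c.Φ (c.pt x).1 (c.pt x).2 = x := (c.existsUnique_pt x).choose_spec.1.2

theorem pt_Φ {i : c.ι} {d : Fin (c.dim i) → ℝ} (hd : ‖d‖ < 1) : c.pt (c.Φ i d) = ⟨i, d⟩ :=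
  ((c.existsUnique_pt (c.Φ i d)).choose_spec.2 ⟨i, d⟩ ⟨hd, rfl⟩).symm

/-- The dimension of the cell containing `x` in its interior. -/
noncomputable def dimAt (x : X) : ℕ := c.dim (c.pt x).1

theorem dimAt_Φ {i : c.ι} {d : Fin (c.dim i) → ℝ} (hd : ‖d‖ < 1) :
    c.dimAt (c.Φ i d) = c.dim i := by
  rw [dimAt, c.pt_Φ hd]

theorem dimAt_Φ_lt {i : c.ι} {d : Fin (c.dim i) → ℝ} (hd : ‖d‖ = 1) :
    c.dimAt (c.Φ i d) < c.dim i := by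
  obtain ⟨j, d', h1, h2, h3⟩ := c.boundary i d hd
  rwa [← h3, c.dimAt_Φ h2]

theorem isOpen_iff {A : Set X} : IsOpen A ↔ ∀ i, IsOpen (c.Φ i ⁻¹' A) :=
  ⟨fun h i => h.preimage (c.Φ i).continuous, c.isOpen_of A⟩

include c in
theorem locallyPathConnectedSpace : LocallyPathConnectedSpace X := by
  let f : (Σ i, (Fin (c.dim i) → ℝ)) → X := fun p => c.Φ p.1 p.2
  have hf : Topology.IsQuotientMap f := by
    refine Topology.isQuotientMap_iff _ |>.2 ⟨⟨?_⟩, fun x => ⟨c.pt x, c.Φ_pt x⟩⟩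
    ext s
    rw [c.isOpen_iff, isOpen_coinduced, isOpen_sigma_iff]
    rfl
  exact hf.locallyPathConnectedSpace

/-- Continuity on an open set, together with some pointwise property, may be proved by passing from
the boundary of each cell to the cell. -/
theorem induction_continuousOn {T : Type*} [TopologicalSpace T] (f : X → T) (Q : X → Prop) {V : Set X}
    (hV : IsOpen V)
    (h : ∀ i, (∀ d, ‖d‖ = 1 → c.Φ i d ∈ V → Q (c.Φ i d)) →
      ContinuousOn (fun d => f (c.Φ i d)) {d | ‖d‖ = 1 ∧ c.Φ i d ∈ V} →
      ContinuousOn (fun d => f (c.Φ i d)) {d | ‖d‖ ≤ 1 ∧ c.Φ i d ∈ V} ∧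
        ∀ d, ‖d‖ < 1 → c.Φ i d ∈ V → Q (c.Φ i d)) :
    ContinuousOn f V ∧ ∀ x ∈ V, Q x := by
  have key : ∀ m i, c.dim i = m → ContinuousOn (fun d => f (c.Φ i d)) (c.Φ i ⁻¹' V) ∧
      ∀ d, ‖d‖ < 1 → c.Φ i d ∈ V → Q (c.Φ i d) := by
    intro m
    induction m using Nat.strong_induction_on with
    | _ m ih =>
      rintro i rfl
      have h1 := h i ?_ ?_
      · refine ⟨?_, h1.2⟩
        have h2 : ContinuousOn (fun d => f (c.Φ i (clampBall d))) (c.Φ i ⁻¹' V) :=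
          h1.1.comp continuous_clampBall.continuousOn fun d hd =>
            ⟨norm_clampBall_le d, by rw [c.Φ_clamp]; exact hd⟩
        exact h2.congr fun d _ => by simp only [c.Φ_clamp]
      · intro d hd hdV
        obtain ⟨j, d', hj, hd', e⟩ := c.boundary i d hd
        rw [← e] at hdV ⊢
        exact (ih _ hj j rfl).2 d' hd' hdV
      · rintro d ⟨hd, hdV⟩
        rw [ContinuousWithinAt, tendsto_nhds]
        intro O hO hdO
        -- Continuity is known so far only on cells of smaller dimension; `attach` converts it into
        -- continuity along the boundary sphere.
        have h2 := c.attach i (f ⁻¹' O ∩ V) (fun j hj => by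
          rw [Set.preimage_inter, Set.inter_comm]
          exact (ih _ hj j rfl).1.isOpen_inter_preimage (hV.preimage (c.Φ j).continuous) hO)
          d hd ⟨hdO, hdV⟩
        have h3 : {d | ‖d‖ = 1 ∧ c.Φ i d ∈ V} ⊆ Metric.sphere 0 1 :=
          fun d hd => mem_sphere_zero_iff_norm.2 hd.1
        exact Filter.Eventually.mono (nhdsWithin_mono _ h3 h2) fun d' hd' => hd'.1
  refine ⟨?_, fun x hx => ?_⟩
  · have : ∀ O, IsOpen O → IsOpen (V ∩ f ⁻¹' O) := fun O hO => by
      rw [c.isOpen_iff]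
      intro i
      exact (key _ i rfl).1.isOpen_inter_preimage (hV.preimage (c.Φ i).continuous) hO
    exact (continuousOn_open_iff hV).2 this
  · have := (key _ (c.pt x).1 rfl).2 (c.pt x).2 (c.norm_pt_lt x)
    rw [c.Φ_pt] at this
    exact this hx

end CellStructure

end TopComplexity

/-! ### Radial functions and contractible neighbourhoods of cells -/

namespace TopComplexity
namespace CellStructure

/-- The radial projection to the unit sphere. -/
noncomputable def dir {n : ℕ} (d : Fin n → ℝ) : Fin n → ℝ := ‖d‖⁻¹ • d

theorem norm_dir {n : ℕ} {d : Fin n → ℝ} (hd : 0 < ‖d‖) : ‖dir d‖ = 1 := by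
  rw [dir, norm_smul, norm_inv, norm_norm, inv_mul_cancel₀ hd.ne']

theorem dir_of_norm_eq_one {n : ℕ} {d : Fin n → ℝ} (hd : ‖d‖ = 1) : dir d = d := by
  rw [dir, hd, inv_one, one_smul]

theorem norm_smul_dir {n : ℕ} {d : Fin n → ℝ} (hd : 0 < ‖d‖) : ‖d‖ • dir d = d := by
  rw [dir, smul_smul, mul_inv_cancel₀ hd.ne', one_smul]

theorem continuousAt_dir {n : ℕ} {d : Fin n → ℝ} (hd : 0 < ‖d‖) : ContinuousAt dir d := by
  unfold dir
  exact (continuous_norm.continuousAt.inv₀ hd.ne').smul continuousAt_id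

variable {X : Type*} [TopologicalSpace X] (c : CellStructure X)

/-- The distance of a point from the centre of its cell. -/
noncomputable def rad (x : X) : ℝ := ‖(c.pt x).2‖

/-- The radial projection of a point to the boundary of its cell. -/
noncomputable def push (x : X) : X := c.Φ (c.pt x).1 (dir (c.pt x).2)

set_option linter.unusedVariables false

variable {c} in
theorem dimAt_push_lt {x : X} (h : 0 < c.rad x) : c.dimAt (c.push x) < c.dimAt x :=
  c.dimAt_Φ_lt (norm_dir h)

theorem rad_Φ {i : c.ι} {d : Fin (c.dim i) → ℝ} (hd : ‖d‖ < 1) : c.rad (c.Φ i d) = ‖d‖ := by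
  rw [rad, c.pt_Φ hd]

theorem push_Φ {i : c.ι} {d : Fin (c.dim i) → ℝ} (hd : ‖d‖ < 1) :
    c.push (c.Φ i d) = c.Φ i (dir d) := by
  rw [push, c.pt_Φ hd]

/-- A partition of unity whose `n`-th function is concentrated near the open `n`-cells. -/
noncomputable def tau (n : ℕ) (x : X) : ℝ :=
  open Classical in
  if c.dimAt x < n then 0
  else if c.dimAt x = n then min 1 (2 * (1 - c.rad x))
  else if h : 0 < c.rad x then max 0 (2 * c.rad x - 1) * tau n (c.push x) else 0
termination_by c.dimAt x
decreasing_by exact dimAt_push_lt h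

theorem exists_rep (x : X) : ∃ i d, ‖d‖ < 1 ∧ c.Φ i d = x :=
  ⟨_, _, c.norm_pt_lt x, c.Φ_pt x⟩

variable {n : ℕ} {i : c.ι} {d : Fin (c.dim i) → ℝ}

theorem tau_of_lt {x : X} (h : c.dimAt x < n) : c.tau n x = 0 := by
  rw [tau, if_pos h]

theorem tau_Φ_lt (hn : c.dim i < n) (hd : ‖d‖ ≤ 1) : c.tau n (c.Φ i d) = 0 := by
  apply c.tau_of_lt
  rcases hd.lt_or_eq with h | h
  · rwa [c.dimAt_Φ h]
  · exact (c.dimAt_Φ_lt h).trans hn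

theorem tau_Φ_eq (hn : c.dim i = n) (hd : ‖d‖ ≤ 1) :
    c.tau n (c.Φ i d) = min 1 (2 * (1 - ‖d‖)) := by
  rcases hd.lt_or_eq with h | h
  · rw [tau, if_neg (by rw [c.dimAt_Φ h]; exact hn.not_lt), if_pos (by rw [c.dimAt_Φ h]; exact hn),
      c.rad_Φ h]
  · rw [c.tau_of_lt (hn ▸ c.dimAt_Φ_lt h), h]
    norm_num

/-- The recursion defining `tau` persists on the boundary sphere, where `dir` is the identity and
the factor is `1`. This closed-ball version is what the cell-by-cell proof of continuity requires.
-/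
theorem tau_Φ_gt (hn : n < c.dim i) (hd : ‖d‖ ≤ 1) :
    c.tau n (c.Φ i d) = max 0 (2 * ‖d‖ - 1) * c.tau n (c.Φ i (dir d)) := by
  rcases hd.lt_or_eq with h | h
  · rw [tau, if_neg (by rw [c.dimAt_Φ h]; exact hn.not_gt), if_neg (by rw [c.dimAt_Φ h]; exact hn.ne')]
    rw [c.rad_Φ h, c.push_Φ h]
    split_ifs with h1
    · rfl
    · rw [max_eq_left (by linarith), zero_mul]
  · rw [dir_of_norm_eq_one h, h]
    norm_num

theorem continuous_tau (n : ℕ) : Continuous (c.tau n) := by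
  rw [← continuousOn_univ]
  refine (c.induction_continuousOn (c.tau n) (fun _ => True) isOpen_univ ?_).1
  intro i _ hS
  refine ⟨?_, fun _ _ _ => trivial⟩
  simp only [Set.mem_univ, and_true] at hS ⊢
  rcases lt_trichotomy (c.dim i) n with hn | hn | hn
  · exact continuousOn_const.congr fun d hd => c.tau_Φ_lt hn hd
  · refine ContinuousOn.congr (f := fun d => min 1 (2 * (1 - ‖d‖))) ?_ fun d hd => c.tau_Φ_eq hn hd
    fun_prop
  · refine ContinuousOn.congr (f := fun d => max 0 (2 * ‖d‖ - 1) * c.tau n (c.Φ i (dir d))) ?_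
      fun d hd => c.tau_Φ_gt hn hd
    intro d hd
    -- `dir` is discontinuous at the centre, but the factor in front vanishes on the ball of radius
    -- `1/2`.
    by_cases h0 : ‖d‖ < 1 / 2
    · refine ContinuousAt.continuousWithinAt (ContinuousAt.congr (f := fun _ => 0)
        continuousAt_const ?_)
      filter_upwards [continuous_norm.continuousAt.eventually (gt_mem_nhds h0)] with d' hd'
      rw [max_eq_left (by linarith), zero_mul]
    · have h0 : 0 < ‖d‖ := by linarith
      refine ContinuousWithinAt.mul (by fun_prop) ?_
      have h1 : ContinuousWithinAt (dir (n := c.dim i)) {d | 0 < ‖d‖} d :=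
        (continuousAt_dir h0).continuousWithinAt
      have h2 := (hS (dir d) (norm_dir h0)).comp h1 fun d' hd' => norm_dir hd'
      exact (h2.continuousAt ((isOpen_lt continuous_const continuous_norm).mem_nhds
        h0)).continuousWithinAt

theorem tau_nonneg (n : ℕ) (x : X) : 0 ≤ c.tau n x := by
  fun_induction tau c n x with
  | case1 => exact le_rfl
  | case2 x h h1 =>
    have := c.norm_pt_lt x
    refine le_min zero_le_one ?_
    rw [rad]
    linarith
  | case3 x h h1 h2 ih => exact mul_nonneg (le_max_left _ _) ih
  | case4 => exact le_rfl

/-- On an `m`-cell at radius `r`, the terms below `m` add up to `max 0 (2r - 1)` times their sum at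
the radial projection, which is `1` by induction when `r > 0`. The `m`-th term `min 1 (2(1 - r))` is
the exact complement, and later terms vanish. -/
theorem sum_tau (N : ℕ) (x : X) : ∑ k ∈ Finset.range N, c.tau k x ≤ 1 ∧
    (c.dimAt x < N → ∑ k ∈ Finset.range N, c.tau k x = 1) := by
  have key : ∀ m x, c.dimAt x = m → ∀ N, ∑ k ∈ Finset.range N, c.tau k x ≤ 1 ∧
      (m < N → ∑ k ∈ Finset.range N, c.tau k x = 1) := by
    intro m
    induction m using Nat.strong_induction_on with
    | _ m ih =>
    intro x hx N
    obtain ⟨i, d, hd, rfl⟩ := c.exists_rep x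
    have hi : c.dim i = m := (c.dimAt_Φ hd).symm.trans hx
    have hlt : 0 < ‖d‖ → c.dimAt (c.Φ i (dir d)) < m := fun h => hi ▸ c.dimAt_Φ_lt (norm_dir h)
    have hsm : ∀ M, M ≤ m → ∑ k ∈ Finset.range M, c.tau k (c.Φ i d) =
        max 0 (2 * ‖d‖ - 1) * ∑ k ∈ Finset.range M, c.tau k (c.Φ i (dir d)) := by
      intro M hM
      rw [Finset.mul_sum]
      refine Finset.sum_congr rfl fun k hk => ?_
      exact c.tau_Φ_gt (by rw [hi]; exact (Finset.mem_range.1 hk).trans_le hM) hd.le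
    have hub : ∀ M, M ≤ m → ∑ k ∈ Finset.range M, c.tau k (c.Φ i d) ≤ max 0 (2 * ‖d‖ - 1) := by
      intro M hM
      rw [hsm M hM]
      rcases (norm_nonneg d).eq_or_lt with h0 | h0
      · rw [← h0]; norm_num
      · have := (ih _ (hlt h0) _ rfl M).1
        exact mul_le_of_le_one_right (le_max_left _ _) this
    have hm1 : ∑ k ∈ Finset.range m, c.tau k (c.Φ i d) = max 0 (2 * ‖d‖ - 1) := by
      rw [hsm m le_rfl]
      rcases (norm_nonneg d).eq_or_lt with h0 | h0
      · rw [← h0]; norm_num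
      · have h1 := hlt h0
        rw [(ih _ h1 _ rfl m).2 h1, mul_one]
    have hge : m < N → ∑ k ∈ Finset.range N, c.tau k (c.Φ i d) = 1 := by
      intro hN
      induction N, hN using Nat.le_induction with
      | base =>
        rw [Finset.sum_range_succ, hm1, c.tau_Φ_eq hi hd.le]
        rcases le_total (2 * ‖d‖) 1 with h | h
        · rw [max_eq_left (by linarith), min_eq_left (by linarith)]; norm_num
        · rw [max_eq_right (by linarith), min_eq_right (by linarith)]; ring
      | succ N hN ih' =>
        rw [Finset.sum_range_succ, ih', c.tau_of_lt (hx ▸ hN), add_zero]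
    refine ⟨?_, hge⟩
    rcases le_or_gt N m with h | h
    · exact (hub N h).trans (max_le zero_le_one (by linarith))
    · exact (hge h).le
  exact key _ x rfl N

/-- The `n`-cell which a point close to the open `n`-cells is close to. -/
noncomputable def cellAt (n : ℕ) (x : X) : c.ι :=
  open Classical in
  if h : n < c.dimAt x ∧ 0 < c.rad x then cellAt n (c.push x) else (c.pt x).1
termination_by c.dimAt x
decreasing_by exact dimAt_push_lt h.2

/-- The radial deformation of the neighbourhood `{x | 0 < c.tau n x}` of the open `n`-cells to the
centres of these cells. -/
noncomputable def contr (n : ℕ) (x : X) : ℝ → X :=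
  open Classical in
  if c.dimAt x ≤ n then fun t => c.Φ (c.pt x).1 ((1 - t) • (c.pt x).2)
  else if h : 0 < c.rad x then fun t =>
    -- The point moves outwards at unit speed and meets the boundary at time `1 - rad`; the
    -- remaining time, of length `rad`, is rescaled to the unit interval for the deformation of the
    -- projected point.
    if t ≤ 1 - c.rad x then c.Φ (c.pt x).1 ((c.rad x + t) • dir (c.pt x).2)
    else contr n (c.push x) ((t - (1 - c.rad x)) / c.rad x)
  else fun _ => x
termination_by c.dimAt x
decreasing_by exact dimAt_push_lt h

theorem cellAt_Φ_eq (hn : c.dim i = n) (hd : ‖d‖ < 1) : c.cellAt n (c.Φ i d) = i := by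
  rw [cellAt, dif_neg (fun h => lt_irrefl n (by rw [c.dimAt_Φ hd] at h; exact h.1.trans_eq hn)), c.pt_Φ hd]

theorem cellAt_Φ_gt (hn : n < c.dim i) (hd : ‖d‖ ≤ 1) (h0 : 0 < ‖d‖) :
    c.cellAt n (c.Φ i d) = c.cellAt n (c.Φ i (dir d)) := by
  rcases hd.lt_or_eq with h | h
  · rw [cellAt, dif_pos (by rw [c.dimAt_Φ h, c.rad_Φ h]; exact ⟨hn, h0⟩), c.push_Φ h]
  · rw [dir_of_norm_eq_one h]

theorem contr_zero (n : ℕ) (x : X) : c.contr n x 0 = x := by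
  rw [contr]
  split_ifs with h1 h2
  · simp [c.Φ_pt]
  · have := c.norm_pt_lt x
    have h3 : (0 : ℝ) ≤ 1 - c.rad x := by rw [rad]; linarith
    simp only [if_pos h3, add_zero]
    exact (congrArg _ (norm_smul_dir h2)).trans (c.Φ_pt x)
  · rfl

theorem contr_Φ_eq (hn : c.dim i = n) (hd : ‖d‖ < 1) (t : ℝ) :
    c.contr n (c.Φ i d) t = c.Φ i ((1 - t) • d) := by
  rw [contr, if_pos (by rw [c.dimAt_Φ hd, hn]), c.pt_Φ hd]

theorem contr_Φ_gt (hn : n < c.dim i) (hd : ‖d‖ ≤ 1) (h0 : 0 < ‖d‖) {t : ℝ} (ht : 0 ≤ t) :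
    c.contr n (c.Φ i d) t = if t ≤ 1 - ‖d‖ then c.Φ i ((‖d‖ + t) • dir d)
      else c.contr n (c.Φ i (dir d)) ((t - (1 - ‖d‖)) / ‖d‖) := by
  rcases hd.lt_or_eq with h | h
  · rw [contr, if_neg (by rw [c.dimAt_Φ h]; exact hn.not_ge), dif_pos (by rwa [c.rad_Φ h]),
      c.rad_Φ h, c.push_Φ h, c.pt_Φ h]
  · rw [dir_of_norm_eq_one h, h]
    split_ifs with h1
    · have : t = 0 := le_antisymm (by linarith) ht
      rw [this, add_zero, one_smul, c.contr_zero]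
    · simp

theorem isOpen_tau_pos (n : ℕ) : IsOpen {x | 0 < c.tau n x} :=
  isOpen_lt continuous_const (c.continuous_tau n)

variable {c} in
-- This dichotomy drives the arguments below: where `tau n` is positive, a point is interior to an
-- `n`-cell, or it sits off-centre in a higher cell and its radial projection is again in the same
-- open set.
theorem tau_Φ_pos (hd : ‖d‖ ≤ 1) (h : 0 < c.tau n (c.Φ i d)) : (c.dim i = n ∧ ‖d‖ < 1) ∨
    (n < c.dim i ∧ 0 < ‖d‖ ∧ 0 < c.tau n (c.Φ i (dir d))) := by
  rcases lt_trichotomy (c.dim i) n with hn | hn | hn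
  · rw [c.tau_Φ_lt hn hd] at h
    exact absurd h (lt_irrefl _)
  · refine Or.inl ⟨hn, lt_of_le_of_ne hd fun h1 => ?_⟩
    rw [c.tau_Φ_eq hn hd, h1] at h
    norm_num at h
  · refine Or.inr ⟨hn, ?_⟩
    rw [c.tau_Φ_gt hn hd] at h
    refine ⟨lt_of_le_of_ne (norm_nonneg d) fun h1 => ?_, pos_of_mul_pos_right h (le_max_left _ _)⟩
    rw [← h1] at h
    norm_num at h

/-- With the set of cells given the discrete topology, local constancy is continuity and can be
checked cell by cell: `cellAt` is constant on an `n`-cell and factors through `dir` on a higher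
cell. -/
theorem cellAt_locallyConst (n : ℕ) : (∀ i, IsOpen {x | 0 < c.tau n x ∧ c.cellAt n x = i}) ∧
    ∀ x, 0 < c.tau n x → c.dim (c.cellAt n x) = n := by
  let _ : TopologicalSpace c.ι := ⊥
  have : DiscreteTopology c.ι := ⟨rfl⟩
  have key := c.induction_continuousOn (c.cellAt n) (fun x => c.dim (c.cellAt n x) = n)
    (c.isOpen_tau_pos n) ?_
  · exact ⟨fun i => key.1.isOpen_inter_preimage (c.isOpen_tau_pos n) (isOpen_discrete {i}), key.2⟩
  intro i hQ hS
  constructor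
  · intro d hd
    rcases tau_Φ_pos hd.1 hd.2 with ⟨hn, h1⟩ | ⟨hn, h0, hV⟩
    · refine ContinuousWithinAt.congr (f := fun _ => i) continuousWithinAt_const ?_
        (c.cellAt_Φ_eq hn h1)
      intro d' hd'
      rcases tau_Φ_pos hd'.1 hd'.2 with ⟨hn, h1⟩ | ⟨hn', h0, hV⟩
      · exact c.cellAt_Φ_eq hn h1
      · exact absurd hn hn'.ne'
    · have h1 : ContinuousWithinAt (dir (n := c.dim i)) {d | ‖d‖ ≤ 1 ∧ 0 < c.tau n (c.Φ i d)} d :=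
        (continuousAt_dir h0).continuousWithinAt
      refine ((hS (dir d) ⟨norm_dir h0, hV⟩).comp h1 ?_).congr ?_ (c.cellAt_Φ_gt hn hd.1 h0)
      · intro d' hd'
        rcases tau_Φ_pos hd'.1 hd'.2 with ⟨hn', h1⟩ | ⟨_, h0', hV'⟩
        · exact absurd hn' hn.ne'
        · exact ⟨norm_dir h0', hV'⟩
      · intro d' hd'
        rcases tau_Φ_pos hd'.1 hd'.2 with ⟨hn', h1⟩ | ⟨_, h0', hV'⟩
        · exact absurd hn' hn.ne'
        · exact c.cellAt_Φ_gt hn hd'.1 h0'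
  · intro d hd hV
    rcases tau_Φ_pos hd.le hV with ⟨hn, h1⟩ | ⟨hn, h0, hV⟩
    · rw [c.cellAt_Φ_eq hn h1, hn]
    · rw [c.cellAt_Φ_gt hn hd.le h0]
      exact hQ _ (norm_dir h0) hV

/-- The path along which `contr` moves a point. -/
noncomputable def contrI (n : ℕ) (x : X) : C(I, X) :=
  open Classical in
  if h : Continuous fun t : I => c.contr n x t then ⟨_, h⟩ else .const I x

theorem contrI_apply {x : X} (h : Continuous fun t : I => c.contr n x t) (t : I) :
    c.contrI n x t = c.contr n x t := by
  rw [contrI, dif_pos h]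
  rfl

/-- Treating the deformation as a map into the path space makes `induction_continuousOn` applicable.
The pointwise continuity of each path is carried along in the same induction, since without it
`contrI` takes only its default value. -/
theorem contrI_aux (n : ℕ) : ContinuousOn (c.contrI n) {x | 0 < c.tau n x} ∧
    ∀ x ∈ {x | 0 < c.tau n x}, Continuous (fun t : I => c.contr n x t) ∧
      c.contr n x 1 = c.Φ (c.cellAt n x) 0 := by
  refine c.induction_continuousOn (c.contrI n) _ (c.isOpen_tau_pos n) ?_
  intro i hQ hS
  -- Joint continuity on one closed cell is enough, by currying.
  suffices h : Continuous (fun p : {d | ‖d‖ ≤ 1 ∧ 0 < c.tau n (c.Φ i d)} × I =>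
      c.contr n (c.Φ i p.1) p.2) by
    have hcont : ∀ d : {d | ‖d‖ ≤ 1 ∧ 0 < c.tau n (c.Φ i d)},
        Continuous fun t : I => c.contr n (c.Φ i d) t := fun d => h.comp (Continuous.prodMk_right d)
    constructor
    · change ContinuousOn _ {d | ‖d‖ ≤ 1 ∧ 0 < c.tau n (c.Φ i d)}
      rw [continuousOn_iff_continuous_domRestrict]
      refine (ContinuousMap.curry ⟨_, h⟩).continuous.congr fun d => ?_
      ext t
      exact (c.contrI_apply (hcont d) t).symm
    · intro d hd hV
      refine ⟨hcont ⟨d, hd.le, hV⟩, ?_⟩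
      rcases tau_Φ_pos hd.le hV with ⟨hn, h1⟩ | ⟨hn, h0, hV⟩
      · rw [c.contr_Φ_eq hn h1, c.cellAt_Φ_eq hn h1]
        simp
      · rw [c.contr_Φ_gt hn hd.le h0 zero_le_one, if_neg (by linarith), c.cellAt_Φ_gt hn hd.le h0,
          ← (hQ _ (norm_dir h0) hV).2]
        congr 1
        field_simp
        ring
  by_cases hn : n < c.dim i
  swap
  · have hn' : ∀ d : {d | ‖d‖ ≤ 1 ∧ 0 < c.tau n (c.Φ i d)}, c.dim i = n ∧ ‖d.1‖ < 1 := by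
      rintro ⟨d, hd1, hd2⟩
      rcases tau_Φ_pos hd1 hd2 with h | h
      · exact h
      · exact absurd h.1 hn
    refine Continuous.congr (f := fun p : {d | ‖d‖ ≤ 1 ∧ 0 < c.tau n (c.Φ i d)} × I =>
      c.Φ i ((1 - (p.2 : ℝ)) • p.1.1)) (by fun_prop) fun p => ?_
    exact (c.contr_Φ_eq (hn' p.1).1 (hn' p.1).2 _).symm
  have hd : ∀ d : {d | ‖d‖ ≤ 1 ∧ 0 < c.tau n (c.Φ i d)}, 0 < ‖d.1‖ ∧
      0 < c.tau n (c.Φ i (dir d.1)) := by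
    rintro ⟨d, hd1, hd2⟩
    rcases tau_Φ_pos hd1 hd2 with h | h
    · exact absurd h.1 hn.ne'
    · exact h.2
  have hdir : Continuous fun d : {d | ‖d‖ ≤ 1 ∧ 0 < c.tau n (c.Φ i d)} => dir d.1 :=
    continuous_iff_continuousAt.2 fun d =>
      (continuousAt_dir (hd d).1).comp continuous_subtype_val.continuousAt
  have hS' : Continuous fun d : {d | ‖d‖ ≤ 1 ∧ 0 < c.tau n (c.Φ i d)} =>
      c.contrI n (c.Φ i (dir d.1)) :=
    hS.comp_continuous hdir fun d => ⟨norm_dir (hd d).1, (hd d).2⟩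
  have hne : ∀ p : {d | ‖d‖ ≤ 1 ∧ 0 < c.tau n (c.Φ i d)} × I, ‖p.1.1‖ ≠ 0 := fun p => (hd p.1).1.ne'
  -- The projection to `I` has no effect in the branch where it occurs; it only makes that branch a
  -- continuous function everywhere. At the switching time both formulas give the boundary point.
  refine Continuous.congr (f := fun p : {d | ‖d‖ ≤ 1 ∧ 0 < c.tau n (c.Φ i d)} × I =>
    if (p.2 : ℝ) ≤ 1 - ‖p.1.1‖ then c.Φ i ((‖p.1.1‖ + p.2) • dir p.1.1)
    else c.contrI n (c.Φ i (dir p.1.1))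
      (Set.projIcc 0 1 zero_le_one ((p.2 - (1 - ‖p.1.1‖)) / ‖p.1.1‖))) ?_ fun p => ?_
  · refine Continuous.if_le ?_ ?_ (by fun_prop) (by fun_prop) fun p hp => ?_
    · have := hdir.comp (continuous_fst (Y := I))
      simp only [Function.comp_def] at this
      fun_prop
    · refine (hS'.comp continuous_fst).eval (continuous_projIcc.comp ?_)
      fun_prop (disch := exact hne _)
    · rw [hp, sub_self, zero_div, Set.projIcc_left, c.contrI_apply (hQ _ (norm_dir (hd p.1).1)
        (hd p.1).2).1]
      simp [c.contr_zero]
  · have h1 := p.1.2.1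
    rw [c.contr_Φ_gt hn h1 (hd p.1).1 p.2.2.1]
    split_ifs with h
    · rfl
    · rw [c.contrI_apply (hQ _ (norm_dir (hd p.1).1) (hd p.1).2).1, Set.projIcc_of_mem]
      have := p.2.2.2
      refine ⟨div_nonneg (by linarith) (norm_nonneg _), div_le_one_of_le₀ (by linarith)
        (norm_nonneg _)⟩

/-- A neighbourhood of the open cell `i` which contracts in `X` to the centre of the cell. -/
def nbhd (i : c.ι) : Set X := {x | 0 < c.tau (c.dim i) x ∧ c.cellAt (c.dim i) x = i}

theorem isOpen_nbhd (i : c.ι) : IsOpen (c.nbhd i) := (c.cellAt_locallyConst _).1 i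

theorem exists_mem_nbhd {x : X} (h : 0 < c.tau n x) : ∃ i, c.dim i = n ∧ x ∈ c.nbhd i := by
  have h1 := (c.cellAt_locallyConst n).2 x h
  exact ⟨c.cellAt n x, h1, by rw [nbhd, h1]; exact ⟨h, rfl⟩⟩

theorem exists_tau_pos (x : X) : ∃ n, 0 < c.tau n x := by
  by_contra hcon
  push Not at hcon
  have h1 := (c.sum_tau (c.dimAt x + 1) x).2 (Nat.lt_succ_self _)
  rw [Finset.sum_eq_zero fun k _ => le_antisymm (hcon k) (c.tau_nonneg k x)] at h1
  exact zero_ne_one h1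

/-- Disjointness within one dimension lets all cells be handled by a countable family indexed by
dimension. -/
theorem nbhd_inter {i j : c.ι} (hij : c.dim i = c.dim j) {x : X} (hi : x ∈ c.nbhd i)
    (hj : x ∈ c.nbhd j) : i = j := by
  rw [← hi.2, hij, hj.2]

theorem exists_contraction (i : c.ι) : ∃ K : X → C(I, X), ContinuousOn K (c.nbhd i) ∧
    ∀ x ∈ c.nbhd i, K x 0 = x ∧ K x 1 = c.Φ i 0 := by
  have h := c.contrI_aux (c.dim i)
  refine ⟨c.contrI (c.dim i), h.1.mono fun x hx => hx.1, fun x hx => ?_⟩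
  obtain ⟨h1, h2⟩ := h.2 x hx.1
  rw [c.contrI_apply h1, c.contrI_apply h1]
  exact ⟨c.contr_zero _ _, h2.trans (by rw [hx.2])⟩

/-- A locally finite version of `tau`. -/
noncomputable def sigma (n : ℕ) (x : X) : ℝ :=
  max 0 (c.tau n x - 1 / 2 * ∑ k ∈ Finset.range n, c.tau k x)

theorem continuous_sigma (n : ℕ) : Continuous (c.sigma n) := by
  unfold sigma
  have := c.continuous_tau
  fun_prop

theorem sigma_nonneg (n : ℕ) (x : X) : 0 ≤ c.sigma n x := le_max_left _ _

theorem tau_pos_of_sigma_pos {x : X} (h : 0 < c.sigma n x) : 0 < c.tau n x := by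
  have h1 := Finset.sum_nonneg fun k (_ : k ∈ Finset.range n) => c.tau_nonneg k x
  rcases lt_max_iff.1 h with h | h
  · exact absurd h (lt_irrefl _)
  · linarith

theorem exists_sigma_pos (x : X) : ∃ n, 0 < c.sigma n x := by
  classical
  have h := c.exists_tau_pos x
  refine ⟨Nat.find h, lt_max_of_lt_right ?_⟩
  rw [Finset.sum_eq_zero]
  · simpa using Nat.find_spec h
  · intro k hk
    exact le_antisymm (not_lt.1 (Nat.find_min h (Finset.mem_range.1 hk))) (c.tau_nonneg k x)

/-- Near `x` the functions `tau k` with `k ≤ dimAt x` add up to more than `2/3`. Any later `tau n`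
is then below `1/3`, less than half of the preceding sum. -/
theorem sigma_locallyFinite (x : X) : ∃ N, ∀ᶠ y in 𝓝 x, ∀ n, N ≤ n → c.sigma n y = 0 := by
  refine ⟨c.dimAt x + 1, ?_⟩
  have h1 := (c.sum_tau (c.dimAt x + 1) x).2 (Nat.lt_succ_self _)
  have h2 : Continuous fun y => ∑ k ∈ Finset.range (c.dimAt x + 1), c.tau k y :=
    continuous_finsetSum _ fun k _ => c.continuous_tau k
  filter_upwards [h2.continuousAt.eventually (lt_mem_nhds (show (2 / 3 : ℝ) < _ by
    simp only [h1]; norm_num))] with y hy n hn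
  have h3 := (c.sum_tau (n + 1) y).1
  rw [Finset.sum_range_succ] at h3
  have h4 := Finset.sum_le_sum_of_subset_of_nonneg (Finset.range_mono hn)
    fun k _ _ => c.tau_nonneg k y
  exact max_eq_left (by linarith)

end CellStructure
end TopComplexity

-- Path classes and the construction of a universal cover

universe u v

namespace TopComplexity

namespace HomotopyClass

variable {X : Type*} [TopologicalSpace X] {a b c d : X}

open Path.Homotopic.Quotient (symm_trans trans_symm trans_refl refl_trans)

theorem trans_symm_cancel (p : Path.Homotopic.Quotient a b) (q : Path.Homotopic.Quotient c b) :
    (p.trans q.symm).trans q = p := by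
  rw [Path.Homotopic.Quotient.trans_assoc, symm_trans, trans_refl]

theorem trans_trans_symm (p : Path.Homotopic.Quotient a b) (q : Path.Homotopic.Quotient b c) :
    (p.trans q).trans q.symm = p := by
  rw [Path.Homotopic.Quotient.trans_assoc, trans_symm, trans_refl]

theorem trans_right_cancel {p p' : Path.Homotopic.Quotient a b} {q : Path.Homotopic.Quotient b c} (h : p.trans q = p'.trans q) :
    p = p' := by
  rw [← trans_trans_symm p q, h, trans_trans_symm]

theorem symm_trans_trans (p : Path.Homotopic.Quotient a b) (q : Path.Homotopic.Quotient b c) :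
    p.symm.trans (p.trans q) = q := by
  rw [← Path.Homotopic.Quotient.trans_assoc, symm_trans, refl_trans]

theorem trans_symm_trans (p : Path.Homotopic.Quotient b a) (q : Path.Homotopic.Quotient b c) :
    p.trans (p.symm.trans q) = q := by
  rw [← Path.Homotopic.Quotient.trans_assoc, trans_symm, refl_trans]

theorem trans_left_cancel {p : Path.Homotopic.Quotient a b} {q q' : Path.Homotopic.Quotient b c} (h : p.trans q = p.trans q') :
    q = q' := by
  rw [← symm_trans_trans p q, h, symm_trans_trans]

theorem trans_cast {b' : X} (p : Path.Homotopic.Quotient a b) (γ : Path b c) (h : b' = c) :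
    p.trans (.mk (γ.cast rfl h)) = (p.trans (.mk γ)).cast rfl h := by
  subst h
  rw [Path.cast_rfl_rfl, Path.Homotopic.Quotient.cast_rfl_rfl]

/-- The two ways around the boundary of a square are homotopic. -/
theorem trans_eq_of_square (G : C(I × I, X)) (p : Path a b) (q : Path b d) (r : Path a c)
    (s : Path c d) (hp : ∀ t, G (t, 0) = p t) (hq : ∀ t, G (1, t) = q t)
    (hr : ∀ t, G (0, t) = r t) (hs : ∀ t, G (t, 1) = s t) :
    (Path.Homotopic.Quotient.mk p).trans (.mk q) = (Path.Homotopic.Quotient.mk r).trans (.mk s) := by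
  obtain rfl : a = G (0, 0) := by rw [hp, p.source]
  obtain rfl : b = G (1, 0) := by rw [hp, p.target]
  obtain rfl : c = G (0, 1) := by rw [hs, s.source]
  obtain rfl : d = G (1, 1) := by rw [hs, s.target]
  let u : Path (0 : I) 1 := ⟨.id I, rfl, rfl⟩
  have : ContractibleSpace I := (convex_Icc (0 : ℝ) 1).contractibleSpace ⟨0, by simp⟩
  -- The square is contractible, so its two boundary routes are homotopic; apply `G`.
  have h : ((u.prod (Path.refl 0)).trans ((Path.refl 1).prod u)).Homotopic
      (((Path.refl 0).prod u).trans (u.prod (Path.refl 1))) := SimplyConnectedSpace.paths_homotopic _ _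
  have h2 := Path.Homotopic.Quotient.eq.2 (h.map G)
  rw [Path.map_trans, Path.map_trans, Path.Homotopic.Quotient.mk_trans,
    Path.Homotopic.Quotient.mk_trans] at h2
  convert h2 using 3 <;> ext t
  · exact (hp t).symm
  · exact (hq t).symm
  · exact (hr t).symm
  · exact (hs t).symm

/-- The homotopy class of a path given as a continuous map. -/
def ofMap (γ : C(I, X)) : Path.Homotopic.Quotient (γ 0) (γ 1) := Path.Homotopic.Quotient.mk ⟨γ, rfl, rfl⟩

end HomotopyClass

open HomotopyClass

/-- A cover of a space by open sets `W i` with horizontal families `κ i` of classes of paths from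
the base point to the points of `W i`. -/
structure HorizontalCover {X : Type*} [TopologicalSpace X] (x₀ : X) (ι : Type*) where
  W : ι → Set X
  isOpen_W : ∀ i, IsOpen (W i)
  index : X → ι
  mem_W : ∀ x, x ∈ W (index x)
  κ : ι → ∀ x, Path.Homotopic.Quotient x₀ x
  κ_trans : ∀ (i) {x y : X} (η : Path x y), (∀ t, η t ∈ W i) → κ i y = (κ i x).trans (.mk η)

namespace HorizontalCover

variable {X : Type*} [TopologicalSpace X] {x₀ : X} {ι : Type*} (H : HorizontalCover x₀ ι)

/-- The fundamental group, as a discrete fibre. -/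
def Fib (x₀ : X) : Type _ := Path.Homotopic.Quotient x₀ x₀

instance : TopologicalSpace (Fib x₀) := ⊥

instance : DiscreteTopology (Fib x₀) := ⟨rfl⟩

/-- Composition of a loop, seen as an element of the fibre, with a class of paths. -/
noncomputable def act {x : X} (g : Fib x₀) (q : Path.Homotopic.Quotient x₀ x) : Path.Homotopic.Quotient x₀ x :=
  Path.Homotopic.Quotient.trans (x₀ := x₀) (x₁ := x₀) g q

theorem act_trans {x y : X} (g : Fib x₀) (q : Path.Homotopic.Quotient x₀ x)
    (r : Path.Homotopic.Quotient x y) : act g (q.trans r) = (act g q).trans r :=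
  (Path.Homotopic.Quotient.trans_assoc (x₀ := x₀) (x₁ := x₀) g q r).symm

theorem act_trans_trans {x y z : X} (g : Fib x₀) (q : Path.Homotopic.Quotient x₀ x)
    (r : Path.Homotopic.Quotient x y) (s : Path.Homotopic.Quotient y z) :
    (act g (q.trans r)).trans s = (act g q).trans (r.trans s) := by
  rw [act_trans, Path.Homotopic.Quotient.trans_assoc]

/-- The transition from the trivialisation over `W i` to that over `W j`. -/
noncomputable def change (i j : ι) (x : X) (g : Fib x₀) : Fib x₀ :=
  (act g (H.κ i x)).trans (H.κ j x).symm

theorem change_trans (i j : ι) (x : X) (g : Fib x₀) :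
    act (H.change i j x g) (H.κ j x) = act g (H.κ i x) :=
  trans_symm_cancel _ _

theorem act_cancel {x : X} {g g' : Fib x₀} {q : Path.Homotopic.Quotient x₀ x}
    (h : act g q = act g' q) : g = g' :=
  trans_right_cancel h

variable [LocallyPathConnectedSpace X]

/-- The universal cover, as a bundle with discrete fibre. -/
noncomputable def core : FiberBundleCore ι X (Fib x₀) where
  baseSet := H.W
  isOpen_baseSet := H.isOpen_W
  indexAt := H.index
  mem_baseSet_at := H.mem_W
  coordChange := H.change
  coordChange_self i x _ g := trans_trans_symm _ _
  continuousOn_coordChange i j := by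
    rintro ⟨x, g⟩ ⟨hx, -⟩
    apply ContinuousAt.continuousWithinAt
    refine ContinuousAt.congr (f := fun _ => H.change i j x g) continuousAt_const ?_
    have hU : H.W i ∩ H.W j ∈ 𝓝 x := ((H.isOpen_W i).inter (H.isOpen_W j)).mem_nhds hx
    -- On a path-connected neighbourhood inside both sets, the two horizontal families are extended
    -- by the same path, so the transition function is locally constant.
    obtain ⟨U, ⟨hxU, hUp⟩, hUW⟩ := (path_connected_basis x).mem_iff.1 hU
    rw [nhds_prod_eq, nhds_discrete (Fib x₀)]
    filter_upwards [Filter.prod_mem_prod hxU (Filter.mem_pure.2 (Set.mem_singleton g))]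
    rintro ⟨y, g'⟩ ⟨hy, rfl : g' = g⟩
    obtain ⟨η, hη⟩ := hUp.joinedIn x (mem_of_mem_nhds hxU) y hy
    apply act_cancel (q := H.κ j y)
    dsimp only
    rw [change_trans, H.κ_trans i η fun t => (hUW (hη t)).1,
      H.κ_trans j η fun t => (hUW (hη t)).2, act_trans, act_trans, change_trans]
  coordChange_comp i j k x _ g := by
    apply act_cancel (q := H.κ k x)
    rw [change_trans, change_trans, change_trans]

/-- The universal cover. -/
abbrev Cover : Type _ := H.core.TotalSpace

/-- The projection of the universal cover. -/
noncomputable def proj (e : H.Cover) : X := e.1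

theorem isCoveringMap_proj : IsCoveringMap H.proj :=
  FiberBundle.isCoveringMap (F := Fib x₀) (E := H.core.Fiber)

/-- The class of paths from the base point corresponding to a point of the universal cover. -/
noncomputable def cls (e : H.Cover) : Path.Homotopic.Quotient x₀ (H.proj e) :=
  act (x₀ := x₀) e.2 (H.κ (H.index e.1) e.1)

/-- The path class of a point of the cover can be read in any trivialisation, not only in its
preferred one. -/
theorem cls_eq (i : ι) (e : H.Cover) : H.cls e =
    act (H.core.localTriv i e).2 (H.κ i e.1) :=
  (H.change_trans _ _ _ _).symm

theorem exists_cls (x : X) (q : Path.Homotopic.Quotient x₀ x) :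
    ∃ e : H.Cover, ∃ h : H.proj e = x, H.cls e = q.cast rfl h := by
  refine ⟨⟨x, q.trans (H.κ (H.index x) x).symm⟩, rfl, ?_⟩
  exact (trans_symm_cancel _ _).trans (Path.Homotopic.Quotient.cast_rfl_rfl _).symm

theorem ext_cls {e e' : H.Cover} (h : H.proj e = H.proj e')
    (h' : H.cls e = (H.cls e').cast rfl h) : e = e' := by
  obtain ⟨x, g⟩ := e
  obtain ⟨x', g'⟩ := e'
  obtain rfl : x = x' := h
  have h'' := h'.trans (Path.Homotopic.Quotient.cast_rfl_rfl _)
  exact congrArg _ (trans_right_cancel h'')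

/-- Carry the class at time `t` back to time `0` along the projected path. In a trivialisation the
fibre coordinate is locally constant and the horizontal class follows the path, so the result is
locally constant on `I`, hence constant. -/
theorem cls_ofMap (Γ : C(I, H.Cover)) : H.cls (Γ 1) = (H.cls (Γ 0)).trans
    (ofMap ((⟨H.proj, H.isCoveringMap_proj.continuous⟩ : C(H.Cover, X)).comp Γ)) := by
  let γ : Path (H.proj (Γ 0)) (H.proj (Γ 1)) :=
    ⟨(⟨H.proj, H.isCoveringMap_proj.continuous⟩ : C(H.Cover, X)).comp Γ, rfl, rfl⟩
  let φ : I → Path.Homotopic.Quotient x₀ (γ 0) := fun t =>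
    (H.cls (Γ t)).trans (.mk (γ.subpath t 0))
  have hsub : ∀ r s t : I, (Path.Homotopic.Quotient.mk (γ.subpath r s)).trans
      (.mk (γ.subpath s t)) = .mk (γ.subpath r t) := fun r s t =>
    Path.Homotopic.Quotient.eq.2 ⟨Path.Homotopy.subpathTransSubpath γ r s t⟩
  have hφ : IsLocallyConstant φ := by
    rw [IsLocallyConstant.iff_eventually_eq]
    intro t₀
    let i := H.index (γ t₀)
    have h1 : Γ t₀ ∈ (H.core.localTriv i).source :=
      (H.core.mem_localTriv_source i _).2 (H.mem_W (γ t₀))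
    have h2 : ContinuousAt (fun t => (H.core.localTriv i (Γ t)).2) t₀ :=
      continuous_snd.continuousAt.comp
        (((H.core.localTriv i).continuousAt h1).comp Γ.continuous.continuousAt)
    have h3 : ∀ᶠ t in 𝓝 t₀, (H.core.localTriv i (Γ t)).2 = (H.core.localTriv i (Γ t₀)).2 :=
      h2.eventually (p := (· = (H.core.localTriv i (Γ t₀)).2))
        (by rw [nhds_discrete]; exact Filter.eventually_pure.2 rfl)
    have h4 : ∀ᶠ t in 𝓝 t₀, γ t ∈ H.W i :=
      γ.continuous.continuousAt ((H.isOpen_W i).mem_nhds (H.mem_W (γ t₀)))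
    obtain ⟨ε, hε, hball⟩ := Metric.mem_nhds_iff.1 h4
    filter_upwards [h3, Metric.ball_mem_nhds t₀ hε] with t ht htε
    have h5 : ∀ s, γ.subpath t₀ t s ∈ H.W i := by
      intro s
      have : γ.subpath t₀ t s ∈ Set.range (γ.subpath t₀ t) := ⟨s, rfl⟩
      rw [Path.range_subpath] at this
      obtain ⟨r, hr, e⟩ := this
      rw [← e]
      apply hball
      have hr' : (r : ℝ) ∈ Set.uIcc (t₀ : ℝ) t := hr
      exact (Real.dist_left_le_of_mem_uIcc hr').trans_lt (by rw [dist_comm]; exact htε) |> fun h => by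
        rw [Metric.mem_ball, dist_comm]; exact h
    simp only [φ]
    rw [H.cls_eq i (Γ t), H.cls_eq i (Γ t₀), ht]
    have h6 : H.κ i (Γ t).1 = (H.κ i (Γ t₀).1).trans (.mk (γ.subpath t₀ t)) :=
      H.κ_trans i (γ.subpath t₀ t) h5
    rw [h6, ← hsub t₀ t 0]
    exact act_trans_trans _ _ _ _
  have h : (H.cls (Γ 1)).trans (.mk (γ.subpath 1 0)) = (H.cls (Γ 0)).trans (.mk (γ.subpath 0 0)) :=
    hφ.apply_eq_of_preconnectedSpace 1 0
  have h' := congrArg (fun q => q.trans (.mk (γ.subpath 0 1))) h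
  simp only [Path.Homotopic.Quotient.trans_assoc, hsub] at h'
  rw [Path.subpath_self, Path.Homotopic.Quotient.mk_refl] at h'
  exact (Path.Homotopic.Quotient.trans_refl _).symm.trans (h'.trans (by rw [Path.subpath_zero_one]; rfl))

theorem cls_path {e e' : H.Cover} (Γ : Path e e') : H.cls e' =
    (H.cls e).trans (.mk (Γ.map H.isCoveringMap_proj.continuous)) := by
  obtain ⟨Γ, rfl, rfl⟩ := Γ
  exact H.cls_ofMap Γ

theorem exists_lift (e : H.Cover) {x : X} (γ : Path (H.proj e) x) :
    ∃ (e' : H.Cover) (h : H.proj e' = x) (Γ : Path e e'),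
      Γ.map H.isCoveringMap_proj.continuous = γ.cast rfl h := by
  have hcov := H.isCoveringMap_proj
  have hl : H.proj ∘ hcov.liftPath γ e γ.source = γ := hcov.liftPath_lifts _ _ _
  refine ⟨hcov.liftPath γ e γ.source 1, (congrFun hl 1).trans γ.target,
    ⟨hcov.liftPath γ e γ.source, hcov.liftPath_zero _ _ _, rfl⟩, ?_⟩
  ext t
  exact congrFun hl t

/-- Points over the same base point are separated by their path class. Lifting a path of class
`cls(e)⁻¹ · cls(e')` from `e` therefore ends at `e'`. Two paths with the same end points have
homotopic projections, and a covering map is injective on path classes. -/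
theorem isUniversalCover_proj [PathConnectedSpace X] : IsUniversalCover H.proj := by
  have hcov := H.isCoveringMap_proj
  refine ⟨hcov, fun x => ?_, simply_connected_iff_paths_homotopic.2 ⟨⟨?_, ?_⟩, ?_⟩⟩
  · obtain ⟨e, h, -⟩ := H.exists_cls x (.mk (PathConnectedSpace.somePath x₀ x))
    exact ⟨e, h⟩
  · obtain ⟨e, -⟩ := H.exists_cls x₀ (.refl x₀)
    exact ⟨e⟩
  · intro e e'
    obtain ⟨γ, hγ⟩ := Path.Homotopic.Quotient.mk_surjective ((H.cls e).symm.trans (H.cls e'))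
    obtain ⟨e₁, h, Γ, hΓ⟩ := H.exists_lift e γ
    have h1 : e₁ = e' := by
      refine H.ext_cls h ?_
      rw [H.cls_path Γ, hΓ, trans_cast, hγ, trans_symm_trans]
    exact ⟨Γ.cast rfl h1.symm⟩
  · intro e e'
    refine ⟨fun q q' => hcov.injective_path_homotopic_map e e' ?_⟩
    obtain ⟨γ, rfl⟩ := Path.Homotopic.Quotient.mk_surjective q
    obtain ⟨γ', rfl⟩ := Path.Homotopic.Quotient.mk_surjective q'
    exact trans_left_cancel ((H.cls_path γ).symm.trans (H.cls_path γ'))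

end HorizontalCover

namespace CellStructure

variable {X : Type*} [TopologicalSpace X] (c : CellStructure X)

/-- The horizontal cover of a cell complex by neighbourhoods which contract to points. -/
noncomputable def horizontalCover [PathConnectedSpace X] (x₀ : X) : HorizontalCover x₀ c.ι where
  W := c.nbhd
  isOpen_W := c.isOpen_nbhd
  index x := (c.exists_mem_nbhd (c.exists_tau_pos x).choose_spec).choose
  mem_W x := (c.exists_mem_nbhd (c.exists_tau_pos x).choose_spec).choose_spec.2
  κ i x :=
    let K := (c.exists_contraction i).choose
    open Classical in
    if h : x ∈ c.nbhd i then
      ((Path.Homotopic.Quotient.mk (PathConnectedSpace.somePath x₀ (c.Φ i 0))).trans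
        (Path.Homotopic.Quotient.mk ⟨K x, ((c.exists_contraction i).choose_spec.2 x h).1,
          ((c.exists_contraction i).choose_spec.2 x h).2⟩).symm)
    else .mk (PathConnectedSpace.somePath x₀ x)
  κ_trans i x y η hη := by
    have hx : x ∈ c.nbhd i := by simpa using hη 0
    have hy : y ∈ c.nbhd i := by simpa using hη 1
    dsimp only
    rw [dif_pos hx, dif_pos hy, Path.Homotopic.Quotient.trans_assoc]
    congr 1
    set K := (c.exists_contraction i).choose with hK
    obtain ⟨hKc, hK1⟩ := (c.exists_contraction i).choose_spec
    have hc : Continuous fun s => K (η s) := hKc.comp_continuous η.continuous hη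
    -- The contraction along `η` sweeps out a square whose far side is constant at the centre of the
    -- cell.
    let G : C(I × I, X) := ⟨fun z => K (η z.1) z.2,
      continuous_eval.comp ((hc.comp continuous_fst).prodMk continuous_snd)⟩
    have hsq := trans_eq_of_square G η ⟨K y, (hK1 y hy).1, (hK1 y hy).2⟩
      ⟨K x, (hK1 x hx).1, (hK1 x hx).2⟩ (Path.refl _) (fun t => (hK1 _ (hη t)).1)
      (fun t => by simp [G]) (fun t => by simp [G]) (fun t => (hK1 _ (hη t)).2)
    rw [Path.Homotopic.Quotient.mk_refl, Path.Homotopic.Quotient.trans_refl] at hsq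
    apply trans_right_cancel (q := .mk ⟨K y, (hK1 y hy).1, (hK1 y hy).2⟩)
    rw [Path.Homotopic.Quotient.trans_assoc, hsq]
    exact (Path.Homotopic.Quotient.symm_trans _).trans
      (Path.Homotopic.Quotient.symm_trans _).symm

/-- Every path-connected cell complex has a universal cover. -/
theorem exists_universalCover {X : Type u} [TopologicalSpace X] [PathConnectedSpace X]
    (c : CellStructure.{v} X) : ∃ (E : Type u) (_ : TopologicalSpace E) (P : E → X),
      IsUniversalCover P := by
  obtain ⟨x₀⟩ : Nonempty X := inferInstance
  have := c.locallyPathConnectedSpace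
  exact ⟨_, _, _, (c.horizontalCover x₀).isUniversalCover_proj⟩

end CellStructure
end TopComplexity

/-! ### Contractibility of the universal cover of an aspherical complex -/

namespace TopComplexity

section NullHomotopy

open CellStructure (dir norm_dir dir_of_norm_eq_one continuousAt_dir)

variable {E : Type*} [TopologicalSpace E] {n : ℕ}

theorem exists_nullhomotopy {x : E} (h : Subsingleton (π_ n E x)) (f : C(Fin n → I, E))
    (hf : ∀ y ∈ Cube.boundary (Fin n), f y = x) :
    ∃ H : C(I × (Fin n → I), E), (∀ y, H (0, y) = f y) ∧ (∀ y, H (1, y) = x) ∧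
      ∀ t, ∀ y ∈ Cube.boundary (Fin n), H (t, y) = x := by
  let p : GenLoop (Fin n) E x := ⟨f, hf⟩
  have hp : GenLoop.Homotopic p GenLoop.const :=
    Quotient.exact (s := GenLoop.Homotopic.setoid (Fin n) x) (h.elim (Quotient.mk _ p) (Quotient.mk _ _))
  obtain ⟨H⟩ := hp
  exact ⟨H.toContinuousMap, fun y => H.apply_zero y, fun y => H.apply_one y,
    fun t y hy => (H.eq_fst t hy).trans (hf y hy)⟩

/-- The affine identification of the unit ball of the sup norm with the unit cube. -/
noncomputable def toCube (v : Fin n → ℝ) : Fin n → I :=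
  fun i => Set.projIcc 0 1 zero_le_one ((v i + 1) / 2)

theorem continuous_toCube : Continuous (toCube (n := n)) :=
  continuous_pi fun i => continuous_projIcc.comp (by fun_prop)

theorem coe_toCube {v : Fin n → ℝ} (hv : ‖v‖ ≤ 1) (i : Fin n) : (toCube v i : ℝ) = (v i + 1) / 2 := by
  have h := abs_le.1 ((norm_le_pi_norm v i).trans hv)
  rw [toCube, Set.projIcc_of_mem _ ⟨by linarith, by linarith⟩]

theorem toCube_mem_boundary [NeZero n] {v : Fin n → ℝ} (hv : ‖v‖ = 1) :
    toCube v ∈ Cube.boundary (Fin n) := by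
  obtain ⟨i, hi⟩ : ∃ i, ‖v i‖ = 1 := by
    by_contra! hcon
    have : ‖v‖ < 1 := (pi_norm_lt_iff one_pos).2 fun i =>
      lt_of_le_of_ne ((norm_le_pi_norm v i).trans hv.le) (hcon i)
    exact this.ne hv
  have h := coe_toCube hv.le i
  refine ⟨i, ?_⟩
  rcases (abs_eq one_pos.le).1 hi with h1 | h1
  · right; ext; rw [h, h1]; norm_num
  · left; ext; rw [h, h1]; norm_num

theorem exists_nullhomotopy_ball [NeZero n] {x : E} (h : Subsingleton (π_ n E x))
    (G : (Fin n → ℝ) → E) (hG : ContinuousOn G {v | ‖v‖ ≤ 1}) (hGx : ∀ v, ‖v‖ = 1 → G v = x) :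
    ∃ H : C(I × (Fin n → ℝ), E), (∀ v, ‖v‖ ≤ 1 → H (0, v) = G v) ∧ (∀ v, H (1, v) = x) ∧
      ∀ t v, ‖v‖ = 1 → H (t, v) = x := by
  let g : (Fin n → I) → (Fin n → ℝ) := fun y i => 2 * y i - 1
  have hg : Continuous g := by fun_prop
  have hgi : ∀ y i, |g y i| ≤ 1 := fun y i => by
    have h0 := (y i).2.1
    have h1 := (y i).2.2
    exact abs_le.2 ⟨by simp only [g]; linarith, by simp only [g]; linarith⟩
  have hg1 : ∀ y, ‖g y‖ ≤ 1 := fun y => (pi_norm_le_iff_of_nonneg zero_le_one).2 (hgi y)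
  have hgb : ∀ y ∈ Cube.boundary (Fin n), ‖g y‖ = 1 := by
    rintro y ⟨i, hi⟩
    refine le_antisymm (hg1 y) ?_
    refine le_trans (le_of_eq ?_) (norm_le_pi_norm (g y) i)
    rcases hi with hi | hi <;> simp only [g, hi] <;> norm_num
  have hinv : ∀ v, ‖v‖ ≤ 1 → g (toCube v) = v := fun v hv => by
    ext i
    simp only [g, coe_toCube hv]
    ring
  obtain ⟨H, h0, h1, hb⟩ := exists_nullhomotopy h ⟨fun y => G (g y), hG.comp_continuous hg hg1⟩
    (fun y hy => hGx _ (hgb y hy))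
  refine ⟨H.comp ⟨fun z => (z.1, toCube z.2), continuous_fst.prodMk
    (continuous_toCube.comp continuous_snd)⟩, fun v hv => ?_, fun v => h1 _,
    fun t v hv => hb _ _ (toCube_mem_boundary hv)⟩
  exact (h0 _).trans (congrArg G (hinv v hv))

/-- The cell on the inner half of the ball, surrounded by the boundary paths run back to `x₀`, is an
`n`-sphere in `E`. A null-homotopy of it fills in the missing paths. -/
theorem exists_extension_pos [NeZero n] {x₀ : E} (h : Subsingleton (π_ n E x₀))
    (Φ : C(Fin n → ℝ, E)) (bd : (Fin n → ℝ) → C(I, E)) (hbd : ContinuousOn bd {d | ‖d‖ = 1})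
    (hbd' : ∀ d, ‖d‖ = 1 → bd d 0 = x₀ ∧ bd d 1 = Φ d) :
    ∃ F : (Fin n → ℝ) → C(I, E), ContinuousOn F {d | ‖d‖ ≤ 1} ∧ (∀ d, ‖d‖ = 1 → F d = bd d) ∧
      ∀ d, ‖d‖ ≤ 1 → F d 0 = x₀ ∧ F d 1 = Φ d := by
  classical
  let G : (Fin n → ℝ) → E := fun d => if ‖d‖ ≤ 1 / 2 then Φ ((2 : ℝ) • d) else
    bd (dir d) (Set.projIcc 0 1 zero_le_one (2 - 2 * ‖d‖))
  have hG : ContinuousOn G {v | ‖v‖ ≤ 1} := by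
    have hc : ContinuousOn (fun d => bd (dir d) (Set.projIcc 0 1 zero_le_one (2 - 2 * ‖d‖)))
        {d | 1 / 2 ≤ ‖d‖} := by
      have h1 : ContinuousOn (fun d => bd (dir d)) {d : Fin n → ℝ | 1 / 2 ≤ ‖d‖} :=
        hbd.comp (fun d hd => (continuousAt_dir (lt_of_lt_of_le one_half_pos hd)).continuousWithinAt)
          fun d hd => norm_dir (lt_of_lt_of_le one_half_pos hd)
      exact continuous_eval.comp_continuousOn
        (h1.prodMk ((continuous_projIcc (h := zero_le_one)).comp
          (f := fun d : Fin n → ℝ => 2 - 2 * ‖d‖) (by fun_prop)).continuousOn)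
    have h1 : ContinuousOn G {d | ‖d‖ ≤ 1 / 2} :=
      (Φ.continuous.comp (continuous_const_smul (2 : ℝ))).continuousOn.congr fun d hd => if_pos hd
    have h2 : ContinuousOn G {d | 1 / 2 ≤ ‖d‖} := hc.congr fun d hd => by
      simp only [G]
      split_ifs with hif
      · have hd2 : ‖d‖ = 1 / 2 := le_antisymm hif hd
        have e : dir d = (2 : ℝ) • d := by rw [dir, hd2]; norm_num
        rw [hd2, Set.projIcc_of_right_le _ (by norm_num), ← e]
        exact ((hbd' _ (norm_dir (by rw [hd2]; norm_num))).2).symm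
      · rfl
    refine (h1.union_of_isClosed h2 (isClosed_le continuous_norm continuous_const)
      (isClosed_le continuous_const continuous_norm)).mono fun d _ => le_total ‖d‖ (1 / 2)
  have hG1 : ∀ v, ‖v‖ = 1 → G v = x₀ := by
    intro v hv
    simp only [G]
    rw [if_neg (by rw [hv]; norm_num), dir_of_norm_eq_one hv, hv,
      Set.projIcc_of_le_left _ (by norm_num)]
    exact (hbd' v hv).1
  obtain ⟨H, h0, h1, hb⟩ := exists_nullhomotopy_ball h G hG hG1
  -- `(u, w)` describes, for each `d`, a path in `I × ball`. It starts on the top or the side, where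
  -- `H` equals `x₀`, and ends at `(0, d/2)`, where `G` equals `Φ d`. For `‖d‖ = 1` it stays at
  -- level `0` and runs along the ray from `d` to `d/2`, where `G` traces `bd d`.
  let u : (Fin n → ℝ) × I → I := fun z =>
    Set.projIcc 0 1 zero_le_one ((1 - (z.2 : ℝ)) * min 1 (2 - 2 * ‖z.1‖))
  let w : (Fin n → ℝ) × I → (Fin n → ℝ) := fun z =>
    ((1 - (z.2 : ℝ)) / max ‖z.1‖ (1 / 2) + z.2 / 2) • z.1
  have hmax : ∀ d : Fin n → ℝ, max ‖d‖ (1 / 2) ≠ 0 := fun d =>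
    (lt_of_lt_of_le one_half_pos (le_max_right _ _)).ne'
  have hu : Continuous u := continuous_projIcc.comp (by fun_prop)
  have hw : Continuous w := by fun_prop (disch := exact fun _ => hmax _)
  let F : C((Fin n → ℝ) × I, E) := H.comp ⟨fun z => (u z, w z), hu.prodMk hw⟩
  refine ⟨F.curry, F.curry.continuous.continuousOn, fun d hd => ?_, fun d hd => ⟨?_, ?_⟩⟩
  · ext t
    have e1 : u (d, t) = 0 := by
      simp only [u, hd]; norm_num [Set.projIcc_left]
    have e2 : w (d, t) = (1 - (t : ℝ) / 2) • d := by
      simp only [w, hd]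
      congr 1
      rw [max_eq_left (by norm_num)]
      ring
    have ht0 := t.2.1
    have ht1 := t.2.2
    have e3 : ‖w (d, t)‖ = 1 - t / 2 := by
      rw [e2, norm_smul, hd, mul_one, Real.norm_of_nonneg (by linarith)]
    change H (u (d, t), w (d, t)) = _
    rw [e1, h0 _ (by rw [e3]; linarith)]
    simp only [G]
    have e4 : dir (w (d, t)) = d := by
      rw [dir, e3, e2, smul_smul, inv_mul_cancel₀ (by linarith), one_smul]
    split_ifs with hif
    · have : (t : ℝ) = 1 := by rw [e3] at hif; linarith
      obtain rfl : t = 1 := Subtype.ext this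
      rw [(hbd' d hd).2, e2, smul_smul]
      norm_num
    · rw [e4, e3]
      congr 1
      ext
      rw [Set.projIcc_of_mem _ ⟨by linarith, by linarith⟩]
      ring
  · change H (u (d, 0), w (d, 0)) = _
    by_cases hd2 : ‖d‖ ≤ 1 / 2
    · have e1 : u (d, 0) = 1 := by
        simp only [u]
        rw [Set.projIcc_of_right_le]
        · rfl
        · rw [min_eq_left (by linarith)]; simp
      rw [e1, h1]
    · apply hb
      push Not at hd2
      simp only [w]
      rw [max_eq_left hd2.le, norm_smul]
      have : 0 < ‖d‖ := by linarith
      simp [this.ne']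
  · change H (u (d, 1), w (d, 1)) = _
    have e1 : u (d, 1) = 0 := by
      simp [u]
    have e2 : w (d, 1) = (1 / 2 : ℝ) • d := by
      simp [w]
    have e3 : ‖w (d, 1)‖ = ‖d‖ / 2 := by rw [e2, norm_smul]; norm_num; ring
    rw [e1, h0 _ (by rw [e3]; linarith)]
    simp only [G]
    rw [if_pos (by rw [e3]; linarith), e2, smul_smul]
    norm_num

theorem exists_extension [PathConnectedSpace E] (h : ∀ n, 1 ≤ n → ∀ x, Subsingleton (π_ n E x))
    {x₀ : E} (Φ : C(Fin n → ℝ, E)) (bd : (Fin n → ℝ) → C(I, E))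
    (hbd : ContinuousOn bd {d | ‖d‖ = 1}) (hbd' : ∀ d, ‖d‖ = 1 → bd d 0 = x₀ ∧ bd d 1 = Φ d) :
    ∃ F : (Fin n → ℝ) → C(I, E), ContinuousOn F {d | ‖d‖ ≤ 1} ∧ (∀ d, ‖d‖ = 1 → F d = bd d) ∧
      ∀ d, ‖d‖ ≤ 1 → F d 0 = x₀ ∧ F d 1 = Φ d := by
  rcases Nat.eq_zero_or_pos n with rfl | hn
  · have h0 : ∀ d : Fin 0 → ℝ, d = 0 := fun d => Subsingleton.elim _ _
    let γ := PathConnectedSpace.somePath x₀ (Φ 0)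
    refine ⟨fun _ => γ, continuousOn_const, fun d hd => ?_, fun d _ => ⟨γ.source, ?_⟩⟩
    · rw [h0 d, norm_zero] at hd
      exact absurd hd (by norm_num)
    · rw [h0 d]; exact γ.target
  · have : NeZero n := ⟨hn.ne'⟩
    exact exists_extension_pos (h n hn x₀) Φ bd hbd hbd'

end NullHomotopy

namespace CellStructure

section Whitehead

variable {E : Type*} [TopologicalSpace E] (c : CellStructure E)

/-- A chosen extension of a family of paths from the boundary of a cell to the cell. -/
noncomputable def ext (x₀ : E) (i : c.ι) (bd : (Fin (c.dim i) → ℝ) → C(I, E)) :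
    (Fin (c.dim i) → ℝ) → C(I, E) :=
  open Classical in
  if h : ∃ F : (Fin (c.dim i) → ℝ) → C(I, E), ContinuousOn F {d | ‖d‖ ≤ 1} ∧
      (∀ d, ‖d‖ = 1 → F d = bd d) ∧ ∀ d, ‖d‖ ≤ 1 → F d 0 = x₀ ∧ F d 1 = c.Φ i d
  then h.choose else fun _ => .const I x₀

/-- Paths from `x₀` to the points of a weakly contractible cell complex, constructed cell by
cell. -/
noncomputable def contraction (x₀ : E) (x : E) : C(I, E) :=
  open Classical in
  c.ext x₀ (c.pt x).1 (fun d => if h : ‖d‖ = 1 then contraction x₀ (c.Φ (c.pt x).1 d)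
    else .const I x₀) (c.pt x).2
termination_by c.dimAt x
decreasing_by exact c.dimAt_Φ_lt h

include c in
/-- A weakly contractible cell complex is contractible. -/
theorem exists_contracting_paths [PathConnectedSpace E]
    (h : ∀ n, 1 ≤ n → ∀ x : E, Subsingleton (π_ n E x)) (x₀ : E) :
    ∃ S : E → C(I, E), Continuous S ∧ ∀ x, S x 0 = x₀ ∧ S x 1 = x := by
  classical
  have key := c.induction_continuousOn (c.contraction x₀)
    (fun x => c.contraction x₀ x 0 = x₀ ∧ c.contraction x₀ x 1 = x) isOpen_univ (fun i hQ hc => ?_)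
  · exact ⟨c.contraction x₀, continuousOn_univ.1 key.1, fun x => key.2 x trivial⟩
  simp only [Set.mem_univ, and_true, forall_const] at hQ hc ⊢
  let bd : (Fin (c.dim i) → ℝ) → C(I, E) := fun d =>
    if ‖d‖ = 1 then c.contraction x₀ (c.Φ i d) else .const I x₀
  have hbd : ∀ d, ‖d‖ = 1 → bd d = c.contraction x₀ (c.Φ i d) := fun d hd => if_pos hd
  have hex := exists_extension h (x₀ := x₀) (c.Φ i) bd (hc.congr hbd)
    (fun d hd => by rw [hbd d hd]; exact hQ d hd)
  have hspec : ContinuousOn (c.ext x₀ i bd) {d | ‖d‖ ≤ 1} ∧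
      (∀ d, ‖d‖ = 1 → c.ext x₀ i bd d = bd d) ∧
      ∀ d, ‖d‖ ≤ 1 → c.ext x₀ i bd d 0 = x₀ ∧ c.ext x₀ i bd d 1 = c.Φ i d := by
    rw [ext, dif_pos hex]
    exact hex.choose_spec
  -- On the interior this is the recursion itself; on the sphere it holds because the chosen
  -- extension restricts to the boundary data.
  have heq : ∀ d, ‖d‖ ≤ 1 → c.contraction x₀ (c.Φ i d) = c.ext x₀ i bd d := by
    intro d hd
    rcases hd.lt_or_eq with hd | hd
    · rw [contraction, c.pt_Φ hd]
      rfl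
    · rw [hspec.2.1 d hd, hbd d hd]
  refine ⟨hspec.1.congr heq, fun d hd => ?_⟩
  rw [heq d hd.le]
  exact hspec.2.2 d hd.le

end Whitehead

section Lift

variable {X : Type u} [TopologicalSpace X] (c : CellStructure.{v} X) {E : Type u}
  [TopologicalSpace E] {P : E → X}

/-- Characteristic maps are defined on all of `ℝⁿ`, a simply connected and locally path-connected
space, so they lift through any covering. -/
theorem exists_lift (hP : IsCoveringMap P) (i : c.ι) (d : Fin (c.dim i) → ℝ) (e : E)
    (h : c.Φ i d = P e) : ∃ F : C(Fin (c.dim i) → ℝ, E), P ∘ F = c.Φ i ∧ F d = e := by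
  obtain ⟨F, ⟨h1, h2⟩, -⟩ := hP.existsUnique_continuousMap_lifts (c.Φ i) d e h.symm
  exact ⟨F, h2, h1⟩

/-- Near `d`, the composite of `Φ i` with the inverse of the sheet `φ` agrees with a lift of `Φ i`.
This reduces the weak topology of the cover to that of the base. -/
theorem isOpen_preimage_sheet (hP : IsCoveringMap P) (φ : OpenPartialHomeomorph E X)
    (hφ : P = φ) (A : Set E) (i : c.ι)
    (hA : ∀ F : C(Fin (c.dim i) → ℝ, E), P ∘ F = c.Φ i → IsOpen (F ⁻¹' A)) :
    IsOpen (c.Φ i ⁻¹' (φ.target ∩ φ.symm ⁻¹' A)) := by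
  rw [isOpen_iff_mem_nhds]
  rintro d ⟨hd1, hd2⟩
  obtain ⟨F, hF, hFd⟩ := c.exists_lift hP i d (φ.symm (c.Φ i d)) (by rw [hφ, φ.right_inv hd1])
  have h1 : ∀ᶠ d' in 𝓝 d, F d' ∈ φ.source :=
    F.continuous.continuousAt (φ.open_source.mem_nhds (by rw [hFd]; exact φ.map_target hd1))
  have h2 : ∀ᶠ d' in 𝓝 d, F d' ∈ A := (hA F hF).mem_nhds (by
    change F d ∈ A
    rw [hFd]; exact hd2)
  filter_upwards [h1, h2] with d' h1 h2
  have e : c.Φ i d' = φ (F d') := by rw [← hφ]; exact (congrFun hF d').symm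
  refine ⟨by rw [e]; exact φ.map_source h1, ?_⟩
  change φ.symm (c.Φ i d') ∈ A
  rwa [e, φ.left_inv h1]

/-- A covering space of a cell complex is a cell complex. -/
noncomputable def lift (hP : IsCoveringMap P) : CellStructure.{max u v} E where
  ι := Σ i, {F : C(Fin (c.dim i) → ℝ, E) // P ∘ F = c.Φ i}
  dim i := c.dim i.1
  Φ i := i.2.1
  Φ_clamp := by
    rintro ⟨i, F, hF⟩ d
    exact congrFun (hP.eq_of_comp_eq (F.continuous.comp continuous_clampBall) F.continuous
      (funext fun d => by
        simpa using (congrFun hF (clampBall d)).trans ((c.Φ_clamp i d).trans (congrFun hF d).symm))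
      0 (by simp [clampBall])) d
  existsUnique_pt x := by
    obtain ⟨⟨i, d⟩, ⟨hd, hx⟩, huniq⟩ := c.existsUnique_pt (P x)
    obtain ⟨F, hF, hFd⟩ := c.exists_lift hP i d x hx
    refine ⟨⟨⟨i, F, hF⟩, d⟩, ⟨hd, hFd⟩, ?_⟩
    rintro ⟨⟨i', F', hF'⟩, d'⟩ ⟨hd', hx'⟩
    have := huniq ⟨i', d'⟩ ⟨hd', by rw [← hx']; exact (congrFun hF' d').symm⟩
    cases this
    obtain rfl : F' = F := DFunLike.coe_injective (hP.eq_of_comp_eq F'.continuous F.continuous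
      (hF'.trans hF.symm) d (hx'.trans hFd.symm))
    rfl
  boundary := by
    rintro ⟨i, F, hF⟩ d hd
    obtain ⟨j, d', hj, hd', e⟩ := c.boundary i d hd
    obtain ⟨F', hF', hFd'⟩ := c.exists_lift hP j d' (F d) (e.trans (congrFun hF d).symm)
    exact ⟨⟨j, F', hF'⟩, d', hj, hd', hFd'⟩
  isOpen_of A hA := by
    rw [isOpen_iff_mem_nhds]
    intro x hx
    obtain ⟨φ, hxφ, hφ⟩ := hP.isLocalHomeomorph x
    have hN : IsOpen (φ.target ∩ φ.symm ⁻¹' A) := c.isOpen_of _ fun i =>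
      c.isOpen_preimage_sheet hP φ hφ A i fun F hF => hA ⟨i, F, hF⟩
    have h1 : ∀ᶠ y in 𝓝 x, φ y ∈ φ.target ∩ φ.symm ⁻¹' A :=
      (φ.continuousAt hxφ) (hN.mem_nhds ⟨φ.map_source hxφ, by
        change φ.symm (φ x) ∈ A
        rwa [φ.left_inv hxφ]⟩)
    filter_upwards [h1, φ.open_source.mem_nhds hxφ] with y hy hys
    have := hy.2
    rwa [Set.mem_preimage, φ.left_inv hys] at this
  attach := by
    rintro ⟨i, F, hF⟩ A hA d hd hFd
    obtain ⟨φ, hxφ, hφ⟩ := hP.isLocalHomeomorph (F d)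
    have e : ∀ d, c.Φ i d = φ (F d) := fun d => by rw [← hφ]; exact (congrFun hF d).symm
    have h1 := c.attach i (φ.target ∩ φ.symm ⁻¹' A) (fun j hj =>
      c.isOpen_preimage_sheet hP φ hφ A j fun F hF => hA ⟨j, F, hF⟩ hj) d hd
      (by
        rw [e]
        refine ⟨φ.map_source hxφ, ?_⟩
        rwa [Set.mem_preimage, φ.left_inv hxφ])
    have h2 : ∀ᶠ d' in 𝓝[Metric.sphere 0 1] d, F d' ∈ φ.source :=
      nhdsWithin_le_nhds (F.continuous.continuousAt (φ.open_source.mem_nhds hxφ))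
    filter_upwards [h1, h2] with d' h1 h2
    have := h1.2
    rwa [Set.mem_preimage, e, φ.left_inv h2] at this

end Lift

end CellStructure

/-- For `n ≥ 2`, homotopies relative to the boundary of the cube lift through the covering; for `n =
1`, the cover is simply connected. -/
theorem subsingleton_pi_of_universalCover {X : Type*} [TopologicalSpace X]
    (hX : IsAspherical X) {E : Type*} [TopologicalSpace E] {P : E → X} (hP : IsUniversalCover P)
    (n : ℕ) (hn : 1 ≤ n) (x : E) : Subsingleton (π_ n E x) := by
  have := hP.simplyConnected
  rcases hn.lt_or_eq with hn | rfl
  · have hs := hX.subsingleton_pi n hn (P x)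
    refine ⟨fun p q => ?_⟩
    induction p using Quotient.inductionOn with | _ p => ?_
    induction q using Quotient.inductionOn with | _ q => ?_
    have h0 : (0 : Fin n → I) ∈ Cube.boundary (Fin n) := ⟨⟨0, by lia⟩, Or.inl rfl⟩
    have hb : ∀ f : GenLoop (Fin n) E x, ∀ y ∈ Cube.boundary (Fin n),
      ((⟨P, hP.isCoveringMap.continuous⟩ : C(E, X)).comp f.1) y = P x :=
      fun f y hy => congrArg P (f.2 y hy)
    refine Quotient.sound (s := GenLoop.Homotopic.setoid (Fin n) x)
      ((hP.isCoveringMap.homotopicRel_iff_comp ⟨0, h0, (p.2 0 h0).trans (q.2 0 h0).symm⟩).2 ?_)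
    exact Quotient.exact (s := GenLoop.Homotopic.setoid (Fin n) (P x))
      (hs.elim (Quotient.mk _ ⟨_, hb p⟩) (Quotient.mk _ ⟨_, hb q⟩))
  · have : Subsingleton (FundamentalGroup E x) :=
      (simply_connected_iff_paths_homotopic.1 ‹SimplyConnectedSpace E›).2 x x
    exact HomotopyGroup.pi1EquivFundamentalGroup.subsingleton

/-- The universal cover of an aspherical cell complex is contractible. -/
theorem exists_contracting_paths {X : Type u} [TopologicalSpace X] (hX : IsAspherical X)
    (c : CellStructure.{v} X) {E : Type u} [TopologicalSpace E] {P : E → X}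
    (hP : IsUniversalCover P) (x₀ : E) :
    ∃ S : E → C(I, E), Continuous S ∧ ∀ x, S x 0 = x₀ ∧ S x 1 = x := by
  have := hP.simplyConnected
  exact (c.lift hP.isCoveringMap).exists_contracting_paths
    (subsingleton_pi_of_universalCover hX hP) x₀

end TopComplexity

/-! ### A global section of the map from paths to the balanced product -/

namespace TopComplexity

theorem exists_lift_family {A X E : Type*} [TopologicalSpace A] [TopologicalSpace X]
    [TopologicalSpace E] {P : E → X} (hP : IsCoveringMap P) (H : C(A, C(I, X))) (f : C(A, E))
    (h : ∀ a, H a 0 = P (f a)) :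
    ∃ G : C(A, C(I, E)), ∀ a, G a 0 = f a ∧ ∀ t, P (G a t) = H a t := by
  let H' : C(I × A, X) := H.uncurry.comp ⟨Prod.swap, continuous_swap⟩
  let G := hP.liftHomotopy H' f h
  refine ⟨(G.comp ⟨Prod.swap, continuous_swap⟩).curry, fun a => ⟨hP.liftHomotopy_zero H' f h a,
    fun t => congrFun (hP.liftHomotopy_lifts H' f h) (t, a)⟩⟩

theorem exists_lift_family_on {A X E : Type*} [TopologicalSpace A] [TopologicalSpace X]
    [TopologicalSpace E] {P : E → X} (hP : IsCoveringMap P) {s : Set A} {H : A → C(I, X)}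
    (hH : ContinuousOn H s) {f : A → E} (hf : ContinuousOn f s) (h : ∀ a ∈ s, H a 0 = P (f a))
    [Nonempty E] :
    ∃ G : A → C(I, E), ContinuousOn G s ∧ ∀ a ∈ s, G a 0 = f a ∧ ∀ t, P (G a t) = H a t := by
  classical
  obtain ⟨G, hG⟩ := exists_lift_family hP ⟨s.domRestrict H, continuousOn_iff_continuous_domRestrict.1 hH⟩
    ⟨s.domRestrict f, continuousOn_iff_continuous_domRestrict.1 hf⟩ fun a => h a a.2
  obtain ⟨e⟩ := ‹Nonempty E›
  have hGs : ∀ a (ha : a ∈ s), (if h : a ∈ s then G ⟨a, h⟩ else .const I e) = G ⟨a, ha⟩ :=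
    fun a ha => dif_pos ha
  refine ⟨fun a => if h : a ∈ s then G ⟨a, h⟩ else .const I e, ?_, fun a ha => ?_⟩
  · rw [continuousOn_iff_continuous_domRestrict]
    convert! G.continuous using 1
    ext1 a
    exact hGs a a.2
  · dsimp only
    rw [hGs a ha]
    exact hG ⟨a, ha⟩

namespace CellStructure

variable {X E : Type*} [TopologicalSpace X] [TopologicalSpace E] {P : E → X}

/-- Reverse the contraction of the neighbourhood, lift it from one fixed point over the centre of
the cell, and take the end point. -/
theorem exists_section_nbhd (c : CellStructure X) (hP : IsCoveringMap P)
    (hs : Function.Surjective P) [Nonempty E] (i : c.ι) :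
    ∃ k : X → E, ContinuousOn k (c.nbhd i) ∧ ∀ x ∈ c.nbhd i, P (k x) = x := by
  obtain ⟨K, hK, hK1⟩ := c.exists_contraction i
  obtain ⟨e, he⟩ := hs (c.Φ i 0)
  let ρ : C(I, I) := ⟨unitInterval.symm, unitInterval.continuous_symm⟩
  have hc : ContinuousOn (fun x => (K x).comp ρ) (c.nbhd i) :=
    (ContinuousMap.continuous_precomp ρ).comp_continuousOn hK
  obtain ⟨G, hG, hG1⟩ := exists_lift_family_on hP hc (f := fun _ => e) continuousOn_const
    (fun x hx => by simp [ρ, (hK1 x hx).2, he])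
  refine ⟨fun x => G x 1, (continuous_eval_const (1 : I)).comp_continuousOn hG, fun x hx => ?_⟩
  rw [(hG1 x hx).2]
  simp [ρ, (hK1 x hx).1]

theorem exists_section_tau_pos (c : CellStructure X) (hP : IsCoveringMap P)
    (hs : Function.Surjective P) [Nonempty E] (n : ℕ) :
    ∃ k : X → E, ContinuousOn k {x | 0 < c.tau n x} ∧ ∀ x, 0 < c.tau n x → P (k x) = x := by
  classical
  choose k hk hk1 using c.exists_section_nbhd hP hs
  obtain ⟨e⟩ := ‹Nonempty E›
  let k' : X → E := fun x => if h : 0 < c.tau n x then k (c.exists_mem_nbhd h).choose x else e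
  have hk' : ∀ i, c.dim i = n → ∀ x ∈ c.nbhd i, k' x = k i x := by
    intro i hi x hx
    have h : 0 < c.tau n x := by rw [← hi]; exact hx.1
    have h2 := (c.exists_mem_nbhd h).choose_spec
    simp only [k', dif_pos h]
    rw [c.nbhd_inter (h2.1.trans hi.symm) h2.2 hx]
  refine ⟨k', fun x hx => ?_, fun x hx => ?_⟩ <;> obtain ⟨i, hi, hxi⟩ := c.exists_mem_nbhd hx
  · refine (((hk i).continuousAt ((c.isOpen_nbhd i).mem_nhds hxi)).congr ?_).continuousWithinAt
    filter_upwards [(c.isOpen_nbhd i).mem_nhds hxi] with y hy using (hk' i hi y hy).symm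
  · rw [hk' i hi x hxi, hk1 i x hxi]

end CellStructure

section Balanced

variable {X E : Type*} [TopologicalSpace E] {P : E → X}

theorem isOpenQuotientMap_mk (P : E → X) : IsOpenQuotientMap (Quotient.mk (diagonalOrbit P)) := by
  refine ⟨Quotient.mk_surjective, continuous_quotient_mk', fun U hU => ?_⟩
  refine isQuotientMap_quotient_mk'.isOpen_preimage.1 ?_
  have : Quotient.mk (diagonalOrbit P) ⁻¹' (Quotient.mk (diagonalOrbit P) '' U) =
      ⋃ g ∈ deckGroup P, (fun z : E × E => (g z.1, g z.2)) ⁻¹' U := by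
    ext z
    simp only [Set.mem_preimage, Set.mem_image, Set.mem_iUnion]
    constructor
    · rintro ⟨w, hw, e⟩
      obtain ⟨g, hg, rfl⟩ := Quotient.exact e.symm
      exact ⟨g, hg, hw⟩
    · rintro ⟨g, hg, h⟩
      exact ⟨_, h, (Quotient.sound ⟨g, hg, rfl⟩ : Quotient.mk (diagonalOrbit P) z = _).symm⟩
  change IsOpen (Quotient.mk (diagonalOrbit P) ⁻¹' (Quotient.mk (diagonalOrbit P) '' U))
  rw [this]
  exact isOpen_biUnion fun g _ => hU.preimage (by fun_prop)

variable [TopologicalSpace X]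

theorem continuous_balancedProj (hP : Continuous P) : Continuous (balancedProj P) :=
  continuous_quot_lift _ (by fun_prop)

theorem balancedProj_liftProj [LocallyPathConnectedSpace X] (hP : IsUniversalCover P) (γ : C(I, X)) :
    balancedProj P (liftProj hP γ) = (γ 0, γ 1) := by
  obtain ⟨e, he⟩ := hP.surjective (γ 0)
  have hl := hP.isCoveringMap.liftPath_lifts γ e he.symm
  rw [liftProj_eq hP γ (hP.isCoveringMap.liftPath γ e he.symm) (congrFun hl)]
  exact Prod.ext (congrFun hl 0) (congrFun hl 1)

theorem deck_eq (hP : IsUniversalCover P) {g g' : E ≃ₜ E} (hg : g ∈ deckGroup P)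
    (hg' : g' ∈ deckGroup P) {e : E} (h : g e = g' e) : g = g' := by
  have := hP.simplyConnected
  exact DFunLike.coe_injective (hP.isCoveringMap.eq_of_comp_eq g.continuous g'.continuous
    (funext fun x => (hg x).trans (hg' x).symm) e h)

/-- The path from `a` to `b` through the base point of a contraction. -/
noncomputable def joinPath {S : E → C(I, E)} (hS : Continuous S) {x₀ : E}
    (hS0 : ∀ x, S x 0 = x₀) : C(E × E, C(I, E)) :=
  ContinuousMap.curry ⟨fun z : (E × E) × I =>
    -- The path rests at `x₀` during the middle third. That pause is what `joinHomotopy` needs in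
    -- order to end exactly at this path.
    if (z.2 : ℝ) ≤ 1 / 2 then S z.1.1 (Set.projIcc 0 1 zero_le_one (1 - 3 * z.2))
    else S z.1.2 (Set.projIcc 0 1 zero_le_one (3 * z.2 - 2)), by
    refine Continuous.if_le ?_ ?_ (by fun_prop) continuous_const fun z hz => ?_
    · exact continuous_eval.comp ((hS.comp (by fun_prop)).prodMk
        ((continuous_projIcc (h := zero_le_one)).comp (by fun_prop)))
    · exact continuous_eval.comp ((hS.comp (by fun_prop)).prodMk
        ((continuous_projIcc (h := zero_le_one)).comp (by fun_prop)))
    · rw [hz, Set.projIcc_of_le_left _ (by norm_num), Set.projIcc_of_le_left _ (by norm_num)]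
      exact (hS0 _).trans (hS0 _).symm⟩

/-- The deformation of a path to the path with the same end points through the base point of a
contraction. -/
noncomputable def joinHomotopy {S : E → C(I, E)} (hS : Continuous S) : C(C(I, E) × ℝ, C(I, E)) :=
  ContinuousMap.curry ⟨fun z : (C(I, E) × ℝ) × I =>
    -- At `r = 0` the formula is `S (Γ t) 1 = Γ t`. At `r = 1` the path `Γ` is traversed only in the
    -- middle third, where the time argument of `S` is `0` and the value is `x₀`. The end points are
    -- fixed for every `r`.
    let r : ℝ := max 0 (min 1 z.1.2)
    S (z.1.1 (Set.projIcc 0 1 zero_le_one ((1 - r) * z.2 + r * (3 * z.2 - 1))))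
      (Set.projIcc 0 1 zero_le_one ((1 - r) + r * max (1 - 3 * (z.2 : ℝ)) (3 * (z.2 : ℝ) - 2))), by
    have hp : Continuous (Set.projIcc (0 : ℝ) 1 zero_le_one) := continuous_projIcc
    refine continuous_eval.comp ((hS.comp (continuous_eval.comp
      ((continuous_fst.comp continuous_fst).prodMk ?_))).prodMk ?_)
    · exact hp.comp (by fun_prop)
    · exact hp.comp (by fun_prop)⟩

variable {S : E → C(I, E)} (hS : Continuous S) {x₀ : E} (hS0 : ∀ x, S x 0 = x₀)
  (hS1 : ∀ x, S x 1 = x)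

theorem joinPath_apply (a b : E) (t : I) : joinPath hS hS0 (a, b) t =
    if (t : ℝ) ≤ 1 / 2 then S a (Set.projIcc 0 1 zero_le_one (1 - 3 * t))
    else S b (Set.projIcc 0 1 zero_le_one (3 * t - 2)) := rfl

theorem joinHomotopy_apply (Γ : C(I, E)) (r : ℝ) (t : I) : joinHomotopy hS (Γ, r) t =
    S (Γ (Set.projIcc 0 1 zero_le_one ((1 - max 0 (min 1 r)) * t + max 0 (min 1 r) * (3 * t - 1))))
      (Set.projIcc 0 1 zero_le_one
        ((1 - max 0 (min 1 r)) + max 0 (min 1 r) * max (1 - 3 * (t : ℝ)) (3 * (t : ℝ) - 2))) := rfl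

include hS1

theorem joinPath_zero (a b : E) : joinPath hS hS0 (a, b) 0 = a := by
  rw [joinPath_apply, if_pos (by norm_num), Set.projIcc_of_right_le _ (by norm_num)]
  exact hS1 a

theorem joinPath_one (a b : E) : joinPath hS hS0 (a, b) 1 = b := by
  rw [joinPath_apply, if_neg (by norm_num), Set.projIcc_of_right_le _ (by norm_num)]
  exact hS1 b

theorem joinHomotopy_left (Γ : C(I, E)) (r : ℝ) : joinHomotopy hS (Γ, r) 0 = Γ 0 := by
  rw [joinHomotopy_apply, Set.projIcc_of_le_left _ (by simp),
    Set.projIcc_of_right_le _ (by norm_num)]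
  exact hS1 _

theorem joinHomotopy_right (Γ : C(I, E)) (r : ℝ) : joinHomotopy hS (Γ, r) 1 = Γ 1 := by
  have h : 0 ≤ max 0 (min 1 r) := le_max_left _ _
  rw [joinHomotopy_apply, Set.projIcc_of_right_le _ (by norm_num; linarith),
    Set.projIcc_of_right_le _ (by norm_num)]
  exact hS1 _

theorem joinHomotopy_of_le_zero (Γ : C(I, E)) {r : ℝ} (hr : r ≤ 0) : joinHomotopy hS (Γ, r) = Γ := by
  ext t
  have h : max 0 (min 1 r) = 0 := max_eq_left (min_le_of_right_le hr)
  rw [joinHomotopy_apply, h]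
  simp only [sub_zero, one_mul, zero_mul, add_zero, Set.projIcc_val]
  rw [Set.projIcc_right]
  exact hS1 _

omit hS1

theorem joinHomotopy_of_one_le (Γ : C(I, E)) {r : ℝ} (hr : 1 ≤ r) :
    joinHomotopy hS (Γ, r) = joinPath hS hS0 (Γ 0, Γ 1) := by
  ext t
  have h : max 0 (min 1 r) = 1 := by rw [min_eq_left hr]; norm_num
  rw [joinHomotopy_apply, h, joinPath_apply]
  simp only [sub_self, zero_mul, zero_add, one_mul]
  have h0 := t.2.1
  split_ifs with ht
  · rw [max_eq_left (by linarith)]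
    rcases le_total (3 * (t : ℝ) - 1) 0 with h1 | h1
    · rw [Set.projIcc_of_le_left _ h1]; rfl
    · rw [Set.projIcc_of_le_left _ (show 1 - 3 * (t : ℝ) ≤ 0 by linarith)]
      exact (hS0 _).trans (hS0 _).symm
  · rw [max_eq_right (by linarith)]
    rcases le_total 1 (3 * (t : ℝ) - 1) with h1 | h1
    · rw [Set.projIcc_of_right_le _ h1]; rfl
    · rw [Set.projIcc_of_le_left _ (show 3 * (t : ℝ) - 2 ≤ 0 by linarith)]
      exact (hS0 _).trans (hS0 _).symm

end Balanced

/-- If the universal cover of a cell complex is contractible, then every pair of points of the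
universal cover can be joined by a path, continuously and equivariantly. -/
theorem exists_section_liftProj {X E : Type*} [TopologicalSpace X] [TopologicalSpace E]
    [LocallyPathConnectedSpace X] (c : CellStructure X) {P : E → X} (hP : IsUniversalCover P)
    {S : E → C(I, E)} (hS : Continuous S) {x₀ : E} (hS0 : ∀ x, S x 0 = x₀) (hS1 : ∀ x, S x 1 = x) :
    ∃ s : C(BalancedProduct P, C(I, X)), ∀ b, liftProj hP (s b) = b := by
  classical
  have hne : Nonempty E := ⟨x₀⟩
  have hcov := hP.isCoveringMap
  let PC : C(E, X) := ⟨P, hcov.continuous⟩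
  choose k hkc hk using c.exists_section_tau_pos hcov hP.surjective
  -- lifts of paths starting in the domain of a local section
  have hL := fun n => exists_lift_family_on hcov (s := {γ : C(I, X) | 0 < c.tau n (γ 0)})
    (H := id) continuousOn_id (f := fun γ => k n (γ 0))
    ((hkc n).comp (continuous_eval_const (0 : I)).continuousOn fun γ hγ => hγ)
    fun γ hγ => (hk n _ hγ).symm
  choose L hLc hL using hL
  let J := joinHomotopy hS
  let T := joinPath hS hS0
  -- local sections
  have hg : ∀ n (b : BalancedProduct P), 0 < c.tau n (balancedProj P b).1 →
      ∃ g ∈ deckGroup P, g b.out.1 = k n (P b.out.1) := fun n b hb => by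
    have e : (balancedProj P b).1 = P b.out.1 := by
      conv_lhs => rw [← Quotient.out_eq b]
      rfl
    exact exists_deck hP (hk n _ (by rwa [← e])).symm
  -- A deck transformation normalises the representative so that its first entry lies on the section
  -- `k n`. Because deck transformations act freely, the resulting path does not depend on the
  -- representative (`ht`), and the contraction need not be equivariant.
  let t : ℕ → BalancedProduct P → C(I, X) := fun n b =>
    if h : 0 < c.tau n (balancedProj P b).1 then
      PC.comp (T ((hg n b h).choose b.out.1, (hg n b h).choose b.out.2)) else .const I (P x₀)
  have ht : ∀ n (z : E × E) (g : E ≃ₜ E), g ∈ deckGroup P → 0 < c.tau n (P z.1) →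
      g z.1 = k n (P z.1) → t n (Quotient.mk _ z) = PC.comp (T (g z.1, g z.2)) := by
    intro n z g hgm hz hgz
    set b : BalancedProduct P := Quotient.mk _ z with hb
    have hb1 : 0 < c.tau n (balancedProj P b).1 := hz
    simp only [t, dif_pos hb1]
    obtain ⟨h1, h2⟩ := (hg n b hb1).choose_spec
    set g₁ := (hg n b hb1).choose
    obtain ⟨f, hf, hfz⟩ := Quotient.exact (s := diagonalOrbit P) (b.out_eq.trans hb)
    have e1 : f b.out.1 = z.1 := congrArg Prod.fst hfz
    have e2 : f b.out.2 = z.2 := congrArg Prod.snd hfz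
    have hP1 : P z.1 = P b.out.1 := by rw [← e1]; exact hf _
    have : g * f = g₁ := deck_eq hP ((deckGroup P).mul_mem hgm hf) h1 (e := b.out.1) (by
      rw [h2, ← hP1, ← hgz, ← e1]; rfl)
    rw [← this, ← e1, ← e2]
    rfl
  suffices h : ∃ s : BalancedProduct P → C(I, X), Continuous s ∧ ∀ b, liftProj hP (s b) = b by
    obtain ⟨s, hsc, hs⟩ := h
    exact ⟨⟨s, hsc⟩, hs⟩
  -- The functions are pulled back along the first coordinate. The fibrewise deformation lifts a
  -- path from `k n (γ 0)` and applies `joinHomotopy`; since lifted end points do not move, the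
  -- value of `liftProj` is preserved.
  refine exists_section_of_shrinkable (p := liftProj hP)
    (fun n b => c.sigma n (balancedProj P b).1)
    (fun n => (c.continuous_sigma n).comp (continuous_fst.comp (continuous_balancedProj hcov.continuous)))
    (fun n b => c.sigma_nonneg n _) (fun b => c.exists_sigma_pos _)
    (fun b => by
      obtain ⟨N, hN⟩ := c.sigma_locallyFinite (balancedProj P b).1
      exact ⟨N, (continuous_fst.comp (continuous_balancedProj hcov.continuous)).continuousAt.eventually hN⟩)
    t ?_ ?_ (fun n z => PC.comp (J (L n z.1, z.2))) ?_ ?_ ?_ ?_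
  · intro n b hb
    apply ContinuousAt.continuousWithinAt
    induction b using Quotient.inductionOn with | _ z => ?_
    have hz : 0 < c.tau n (P z.1) := c.tau_pos_of_sigma_pos hb
    obtain ⟨g, hgm, hgz⟩ := exists_deck hP (hk n _ hz).symm
    rw [← (isOpenQuotientMap_mk P).continuousAt_comp_iff]
    have h1 : ContinuousAt (fun w : E × E => PC.comp (T (g w.1, g w.2))) z :=
      (ContinuousMap.continuous_postcomp PC).continuousAt.comp
        (T.continuous.continuousAt.comp (by fun_prop))
    refine h1.congr ?_
    have hop : IsOpen {e : E | 0 < c.tau n (P e)} := (c.isOpen_tau_pos n).preimage hcov.continuous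
    have hkP : ContinuousAt (fun e => k n (P e)) z.1 :=
      ((hkc n).continuousAt ((c.isOpen_tau_pos n).mem_nhds hz)).comp hcov.continuous.continuousAt
    obtain ⟨φ, hφ1, hφ⟩ := hcov.isLocalHomeomorph (g z.1)
    -- Both sides lie over `P e` and, near `z.1`, in a single sheet, so one `g` normalises all
    -- nearby representatives.
    have h2 : ∀ᶠ e in 𝓝 z.1, g e = k n (P e) := by
      have a1 : ∀ᶠ e in 𝓝 z.1, g e ∈ φ.source :=
        g.continuous.continuousAt (φ.open_source.mem_nhds hφ1)
      have a2 : ∀ᶠ e in 𝓝 z.1, k n (P e) ∈ φ.source :=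
        hkP (φ.open_source.mem_nhds (by dsimp only; rw [← hgz]; exact hφ1))
      filter_upwards [a1, a2, hop.mem_nhds hz] with e h1 h2 h3
      refine φ.injOn h1 h2 ?_
      rw [← hφ, hk n _ h3]
      exact hgm e
    filter_upwards [continuous_fst.continuousAt.eventually h2,
      continuous_fst.continuousAt.eventually (hop.mem_nhds hz)] with w hw1 hw2
    exact (ht n w g hgm hw2 hw1).symm
  · intro n b hb
    induction b using Quotient.inductionOn with | _ z => ?_
    have hz : 0 < c.tau n (P z.1) := c.tau_pos_of_sigma_pos hb
    obtain ⟨g, hgm, hgz⟩ := exists_deck hP (hk n _ hz).symm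
    rw [ht n z g hgm hz hgz, liftProj_eq hP _ (T (g z.1, g z.2)) (fun _ => rfl)]
    simp only [T, joinPath_zero hS hS0 hS1, joinPath_one hS hS0 hS1]
    exact (Quotient.sound ⟨g, hgm, rfl⟩ : Quotient.mk (diagonalOrbit P) z = _).symm
  · intro n
    have h1 : ContinuousOn (fun z : C(I, X) × ℝ => L n z.1)
        {z | 0 < c.sigma n (balancedProj P (liftProj hP z.1)).1} :=
      (hLc n).comp continuous_fst.continuousOn fun z hz => by
        have := c.tau_pos_of_sigma_pos hz
        rwa [balancedProj_liftProj] at this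
    exact (ContinuousMap.continuous_postcomp PC).comp_continuousOn
      (J.continuous.comp_continuousOn (h1.prodMk continuous_snd.continuousOn))
  all_goals
    intro n γ r hγ
    have hγ' : 0 < c.tau n (γ 0) := by
      have := c.tau_pos_of_sigma_pos hγ
      rwa [balancedProj_liftProj] at this
    obtain ⟨hL0, hL1⟩ := hL n γ hγ'
    have hγL : liftProj hP γ = Quotient.mk _ (L n γ 0, L n γ 1) := liftProj_eq hP γ (L n γ) hL1
  · rw [liftProj_eq hP _ (J (L n γ, r)) (fun _ => rfl), hγL]
    simp only [J, joinHomotopy_left hS hS1, joinHomotopy_right hS hS1]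
  · intro hr
    simp only [J, joinHomotopy_of_le_zero hS hS1 _ hr]
    ext u
    exact hL1 u
  · intro hr
    simp only [J, joinHomotopy_of_one_le hS hS0 _ hr]
    have hPL : P (L n γ 0) = γ 0 := hL1 0
    rw [hγL, ht n (L n γ 0, L n γ 1) 1 (deckGroup P).one_mem (by rw [hPL]; exact hγ')
      (by rw [hPL]; exact hL0)]
    rfl

end TopComplexity

/-! ### The diagonal condition in terms of path classes -/

namespace TopComplexity

namespace HomotopyClass

variable {X Y : Type*} [TopologicalSpace X] [TopologicalSpace Y] {a b c : X}

theorem map_trans (f : C(X, Y)) (p : Path.Homotopic.Quotient a b) (q : Path.Homotopic.Quotient b c) :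
    (p.trans q).map f = (p.map f).trans (q.map f) := by
  induction p using Path.Homotopic.Quotient.ind with | _ p => ?_
  induction q using Path.Homotopic.Quotient.ind with | _ q => ?_
  exact congrArg Path.Homotopic.Quotient.mk (Path.map_trans p q f.continuous)

theorem map_symm (f : C(X, Y)) (p : Path.Homotopic.Quotient a b) :
    p.symm.map f = (p.map f).symm := by
  induction p using Path.Homotopic.Quotient.ind with | _ p => ?_
  exact congrArg Path.Homotopic.Quotient.mk (Path.map_symm p f.continuous)

theorem prod_ext {u w : X × Y} {p q : Path.Homotopic.Quotient u w}
    (h₁ : p.map ⟨Prod.fst, continuous_fst⟩ = q.map ⟨Prod.fst, continuous_fst⟩)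
    (h₂ : p.map ⟨Prod.snd, continuous_snd⟩ = q.map ⟨Prod.snd, continuous_snd⟩) : p = q := by
  obtain ⟨u₁, u₂⟩ := u
  obtain ⟨w₁, w₂⟩ := w
  rw [← Path.Homotopic.prod_projLeft_projRight p, ← Path.Homotopic.prod_projLeft_projRight q]
  exact congrArg₂ _ h₁ h₂

theorem symm_symm (p : Path.Homotopic.Quotient a b) : p.symm.symm = p := by
  induction p using Path.Homotopic.Quotient.ind with | _ p => ?_
  exact congrArg Path.Homotopic.Quotient.mk (Path.symm_symm p)

theorem trans_symm_eq (p : Path.Homotopic.Quotient a b) (q : Path.Homotopic.Quotient b c) :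
    (p.trans q).symm = q.symm.trans p.symm := by
  apply trans_right_cancel (q := p.trans q)
  rw [Path.Homotopic.Quotient.symm_trans, Path.Homotopic.Quotient.trans_assoc, symm_trans_trans,
    Path.Homotopic.Quotient.symm_trans]

theorem conj_map (f : C(X, Y)) (p : Path.Homotopic.Quotient a b) (q : Path.Homotopic.Quotient a a) :
    (p.symm.trans (q.trans p)).map f = (p.map f).symm.trans ((q.map f).trans (p.map f)) := by
  rw [map_trans, map_trans, map_symm]

theorem refl_conj (q : Path.Homotopic.Quotient a a) :
    (Path.Homotopic.Quotient.refl a).symm.trans (q.trans (.refl a)) = q := by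
  rw [Path.Homotopic.Quotient.trans_refl]
  apply trans_left_cancel (p := .refl a)
  rw [trans_symm_trans, Path.Homotopic.Quotient.refl_trans]

theorem conj_of_conj {m₁ : Path.Homotopic.Quotient a c} {m₂ : Path.Homotopic.Quotient b c}
    {d : Path.Homotopic.Quotient c c} {q₁ : Path.Homotopic.Quotient a a}
    {q₂ : Path.Homotopic.Quotient b b} (h₁ : m₁.trans d = q₁.trans m₁)
    (h₂ : m₂.trans d = q₂.trans m₂) :
    q₁.trans (m₁.trans m₂.symm) = (m₁.trans m₂.symm).trans q₂ := by
  apply trans_right_cancel (q := m₂)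
  rw [← Path.Homotopic.Quotient.trans_assoc, ← h₁, trans_symm_cancel,
    Path.Homotopic.Quotient.trans_assoc, ← h₂, Path.Homotopic.Quotient.trans_assoc,
    symm_trans_trans]

theorem conj_eq_conj {p₁ : Path.Homotopic.Quotient a c} {p₂ : Path.Homotopic.Quotient b c}
    {m : Path.Homotopic.Quotient a b} {q₁ : Path.Homotopic.Quotient a a}
    {q₂ : Path.Homotopic.Quotient b b} (h : q₁.trans m = m.trans q₂) :
    (p₂.symm.trans (m.symm.trans p₁)).symm.trans ((p₂.symm.trans (q₂.trans p₂)).trans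
      (p₂.symm.trans (m.symm.trans p₁))) = p₁.symm.trans (q₁.trans p₁) := by
  simp only [trans_symm_eq, symm_symm, Path.Homotopic.Quotient.trans_assoc, trans_symm_trans]
  rw [← Path.Homotopic.Quotient.trans_assoc m, ← h, Path.Homotopic.Quotient.trans_assoc,
    trans_symm_trans]

end HomotopyClass

open HomotopyClass

section Diagonal

variable {Z : Type*} [TopologicalSpace Z]

/-- The first coordinate on a set of pairs. -/
def fstOn (U : Set (Z × Z)) : C(U, Z) := ⟨fun u => u.1.1, by fun_prop⟩

/-- The second coordinate on a set of pairs. -/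
def sndOn (U : Set (Z × Z)) : C(U, Z) := ⟨fun u => u.1.2, by fun_prop⟩

/-- The two coordinates of loops in `U` are conjugate by means of a class of paths between the
coordinates of the base point. -/
def IsConjugateOn (U : Set (Z × Z)) : Prop :=
  ∀ u : U, ∃ c : Path.Homotopic.Quotient (fstOn U u) (sndOn U u),
    ∀ a : Path.Homotopic.Quotient u u, (a.map (fstOn U)).trans c = c.trans (a.map (sndOn U))

/-- Multiplication in `FundamentalGroup` is concatenation in the opposite order, so conjugation by
`g` appears as `g⁻¹ · d · g` on path classes. -/
theorem mem_conj_diagonalSubgroup {z₀ : Z} {u : Z × Z} (δ : Path u (z₀, z₀))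
    (g : FundamentalGroup (Z × Z) (z₀, z₀)) (a : Path.Homotopic.Quotient u u) :
    FundamentalGroup.fundamentalGroupMulEquivOfPath δ a ∈
        (diagonalSubgroup z₀).map (MulAut.conj g).toMonoidHom ↔
      ∃ d : Path.Homotopic.Quotient z₀ z₀,
        (FundamentalGroup.toPath g).symm.trans
            ((d.map (⟨fun x => (x, x), by fun_prop⟩ : C(Z, Z × Z))).trans
              (FundamentalGroup.toPath g)) =
          (Path.Homotopic.Quotient.mk δ).symm.trans (a.trans (.mk δ)) := by
  constructor
  · rintro ⟨_, ⟨d, rfl⟩, h⟩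
    exact ⟨d, h⟩
  · rintro ⟨d, h⟩
    exact ⟨_, ⟨d, rfl⟩, h⟩

theorem map_diag_fst {x y : Z} (d : Path.Homotopic.Quotient x y) :
    (d.map (⟨fun x => (x, x), by fun_prop⟩ : C(Z, Z × Z))).map ⟨Prod.fst, continuous_fst⟩ = d := by
  induction d using Path.Homotopic.Quotient.ind with | _ d => ?_
  rfl

theorem map_diag_snd {x y : Z} (d : Path.Homotopic.Quotient x y) :
    (d.map (⟨fun x => (x, x), by fun_prop⟩ : C(Z, Z × Z))).map ⟨Prod.snd, continuous_snd⟩ = d := by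
  induction d using Path.Homotopic.Quotient.ind with | _ d => ?_
  rfl

theorem map_val_fst {U : Set (Z × Z)} {u w : U} (a : Path.Homotopic.Quotient u w) :
    (a.map (⟨Subtype.val, continuous_subtype_val⟩ : C(U, Z × Z))).map ⟨Prod.fst, continuous_fst⟩ =
      a.map (fstOn U) := by
  induction a using Path.Homotopic.Quotient.ind with | _ a => ?_
  rfl

theorem map_val_snd {U : Set (Z × Z)} {u w : U} (a : Path.Homotopic.Quotient u w) :
    (a.map (⟨Subtype.val, continuous_subtype_val⟩ : C(U, Z × Z))).map ⟨Prod.snd, continuous_snd⟩ =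
      a.map (sndOn U) := by
  induction a using Path.Homotopic.Quotient.ind with | _ a => ?_
  rfl

/-- With `m p` the `p`-coordinate of `δ · g⁻¹`, both `m p₁` and `m p₂` carry a loop's coordinate to
the same loop `d` at `z₀`. Hence `m p₁ · (m p₂)⁻¹` conjugates one coordinate into the other. -/
theorem IsDiagonalOn.isConjugateOn [PathConnectedSpace Z] {z₀ : Z} {U : Set (Z × Z)}
    (h : IsDiagonalOn z₀ U) : IsConjugateOn U := by
  intro u
  let δ : Path (u : Z × Z) (z₀, z₀) := PathConnectedSpace.somePath _ _
  obtain ⟨g, hg⟩ := h u δ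
  let p₁ : C(Z × Z, Z) := ⟨Prod.fst, continuous_fst⟩
  let p₂ : C(Z × Z, Z) := ⟨Prod.snd, continuous_snd⟩
  let m : ∀ p : C(Z × Z, Z), Path.Homotopic.Quotient (p u.1) (p (z₀, z₀)) := fun p =>
    ((Path.Homotopic.Quotient.mk δ).map p).trans ((FundamentalGroup.toPath g).map p).symm
  refine ⟨(m p₁).trans (m p₂).symm, fun a => ?_⟩
  obtain ⟨d, hd⟩ := (mem_conj_diagonalSubgroup δ g
    (a.map (⟨Subtype.val, continuous_subtype_val⟩ : C(U, Z × Z)))).1 (hg a)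
  have key : ∀ p : C(Z × Z, Z), (m p).trans ((d.map
      (⟨fun x => (x, x), by fun_prop⟩ : C(Z, Z × Z))).map p) =
      ((a.map (⟨Subtype.val, continuous_subtype_val⟩ : C(U, Z × Z))).map p).trans (m p) := by
    intro p
    have hp := congrArg (fun q => Path.Homotopic.Quotient.map q p) hd
    simp only [map_trans, map_symm] at hp
    apply trans_right_cancel (q := (FundamentalGroup.toPath g).map p)
    simp only [m, Path.Homotopic.Quotient.trans_assoc]
    erw [hp]
    rw [trans_symm_trans, Path.Homotopic.Quotient.symm_trans]
    exact congrArg _ (Path.Homotopic.Quotient.trans_refl _).symm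
  have k₁ : (m p₁).trans d = (a.map (fstOn U)).trans (m p₁) := by
    have := key p₁
    rwa [map_diag_fst, map_val_fst] at this
  have k₂ : (m p₂).trans d = (a.map (sndOn U)).trans (m p₂) := by
    have := key p₂
    rwa [map_diag_snd, map_val_snd] at this
  exact conj_of_conj k₁ k₂

/-- The conjugating element may be taken trivial in the second coordinate; the first is then forced
to be `δ₂⁻¹ · c⁻¹ · δ₁`. -/
theorem IsConjugateOn.isDiagonalOn {z₀ : Z} {U : Set (Z × Z)}
    (h : IsConjugateOn U) : IsDiagonalOn z₀ U := by
  intro u δ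
  obtain ⟨c, hc⟩ := h u
  let p₁ : C(Z × Z, Z) := ⟨Prod.fst, continuous_fst⟩
  let p₂ : C(Z × Z, Z) := ⟨Prod.snd, continuous_snd⟩
  let δ₁ : Path.Homotopic.Quotient (fstOn U u) z₀ := (Path.Homotopic.Quotient.mk δ).map p₁
  let δ₂ : Path.Homotopic.Quotient (sndOn U u) z₀ := (Path.Homotopic.Quotient.mk δ).map p₂
  let g : FundamentalGroup (Z × Z) (z₀, z₀) := FundamentalGroup.fromPath
    (Path.Homotopic.prod (δ₂.symm.trans (c.symm.trans δ₁)) (.refl z₀))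
  refine ⟨g, fun a => (mem_conj_diagonalSubgroup δ g _).2
    ⟨δ₂.symm.trans ((Path.Homotopic.Quotient.map a (sndOn U)).trans δ₂), ?_⟩⟩
  have hg₁ : g.toPath.map p₁ = δ₂.symm.trans (c.symm.trans δ₁) := Path.Homotopic.projLeft_prod _ _
  have hg₂ : g.toPath.map p₂ = .refl z₀ := Path.Homotopic.projRight_prod _ _
  have hv₁ := map_val_fst (U := U) a
  have hv₂ := map_val_snd (U := U) a
  apply prod_ext
  · refine (conj_map _ _ _).trans (Eq.trans ?_ (conj_map _ _ _).symm)
    rw [map_diag_fst]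
    refine Eq.trans ?_ ((conj_eq_conj (p₁ := δ₁) (p₂ := δ₂) (hc a)).trans (by rw [← hv₁]; rfl))
    · rw [← hg₁]
  · refine (conj_map _ _ _).trans (Eq.trans ?_ (conj_map _ _ _).symm)
    rw [map_diag_snd]
    refine Eq.trans ?_ ((refl_conj (δ₂.symm.trans ((Path.Homotopic.Quotient.map a (sndOn U)).trans
      δ₂))).trans (by rw [← hv₂]; rfl))
    · rw [← hg₂]

end Diagonal

end TopComplexity

/-! ### From conjugacy of loops to sections of the balanced product, and back -/

namespace TopComplexity

open HomotopyClass

section Horizontal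

variable {Z : Type*} [TopologicalSpace Z]

/-- Fix one base point in each path component of `U` and transport its class along paths. The
conjugacy relation for loops makes the outcome compatible with every path in `U`. -/
theorem IsConjugateOn.exists_horizontal {U : Set (Z × Z)} (h : IsConjugateOn U) :
    ∃ C : ∀ u : U, Path.Homotopic.Quotient (fstOn U u) (sndOn U u),
      ∀ (u w : U) (ζ : Path.Homotopic.Quotient u w),
        (ζ.map (fstOn U)).trans (C w) = (C u).trans (ζ.map (sndOn U)) := by
  choose c hc using h
  let base : U → U := fun u => (Quotient.mk (pathSetoid U) u).out
  have hbase : ∀ u, Joined (base u) u := fun u => Quotient.mk_out (s := pathSetoid U) u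
  let η : ∀ u, Path.Homotopic.Quotient (base u) u := fun u => .mk (hbase u).somePath
  refine ⟨fun u => (((η u).map (fstOn U)).symm.trans (c (base u))).trans ((η u).map (sndOn U)),
    fun u w ζ => ?_⟩
  have hb : base u = base w := congrArg Quotient.out
    (Quotient.sound (s := pathSetoid U) (show Joined u w from ⟨ζ.out⟩))
  have gen : ∀ (b b' : U) (_ : b = b') (α : Path.Homotopic.Quotient b u)
      (β : Path.Homotopic.Quotient b' w), (ζ.map (fstOn U)).trans
        (((β.map (fstOn U)).symm.trans (c b')).trans (β.map (sndOn U))) =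
      (((α.map (fstOn U)).symm.trans (c b)).trans (α.map (sndOn U))).trans (ζ.map (sndOn U)) := by
    rintro b _ rfl α β
    have hl := hc b (α.trans (ζ.trans β.symm))
    simp only [map_trans, map_symm] at hl
    apply trans_left_cancel (p := α.map (fstOn U))
    apply trans_right_cancel (q := (β.map (sndOn U)).symm)
    simp only [Path.Homotopic.Quotient.trans_assoc, trans_symm_trans,
      Path.Homotopic.Quotient.trans_symm, Path.Homotopic.Quotient.trans_refl] at hl ⊢
    exact hl
  exact gen _ _ hb (η u) (η w)

/-- The path chosen by the section conjugates: along a loop the section sweeps out a square with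
equal vertical sides. The `Y`-coordinate imposes no condition, as all path classes there agree. -/
theorem isConjugateOn_of_section {X : Type*} [TopologicalSpace X] {U : Set (X × X)}
    (h : HasSectionOver (pathFibration X) U) {Y : Type*} [TopologicalSpace Y]
    [SimplyConnectedSpace Y] :
    IsConjugateOn ((fun z : (X × Y) × (X × Y) => (z.1.1, z.2.1)) ⁻¹' U) := by
  obtain ⟨s, hs⟩ := h
  set V := (fun z : (X × Y) × (X × Y) => (z.1.1, z.2.1)) ⁻¹' U
  let f : C(V, U) := ⟨fun v => ⟨(v.1.1.1, v.1.2.1), v.2⟩, by fun_prop⟩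
  have hs0 : ∀ v : V, s (f v) 0 = v.1.1.1 := fun v => congrArg Prod.fst (hs (f v))
  have hs1 : ∀ v : V, s (f v) 1 = v.1.2.1 := fun v => congrArg Prod.snd (hs (f v))
  let γ : ∀ v : V, Path v.1.1.1 v.1.2.1 := fun v => ⟨s (f v), hs0 v, hs1 v⟩
  intro u
  refine ⟨Path.Homotopic.prod (.mk (γ u)) (.mk (PathConnectedSpace.somePath u.1.1.2 u.1.2.2)),
    fun a => ?_⟩
  have hY : ∀ x y : Y, Subsingleton (Path.Homotopic.Quotient x y) :=
    (simply_connected_iff_paths_homotopic.1 ‹SimplyConnectedSpace Y›).2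
  refine prod_ext ?_ ((hY _ _).elim _ _)
  induction a using Path.Homotopic.Quotient.ind with | _ a => ?_
  refine (map_trans _ _ _).trans (Eq.trans ?_ (map_trans _ _ _).symm)
  let G : C(I × I, X) := (s.comp (f.comp a.toContinuousMap)).uncurry
  have hsq := trans_eq_of_square G (a.map (f := fun v : V => v.1.1.1) (by fun_prop)) (γ u) (γ u)
    (a.map (f := fun v : V => v.1.2.1) (by fun_prop)) (fun t => hs0 _)
    (fun t => congrArg (fun v => s (f v) t) a.target) (fun t => congrArg (fun v => s (f v) t) a.source)
    (fun t => hs1 _)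
  have hp := Path.Homotopic.projLeft_prod (Path.Homotopic.Quotient.mk (γ u))
    (.mk (PathConnectedSpace.somePath u.1.1.2 u.1.2.2))
  exact (congrArg (fun q => Path.Homotopic.Quotient.trans _ q) hp).trans
    (hsq.trans (congrArg (fun q => Path.Homotopic.Quotient.trans q _) hp).symm)

end Horizontal

section Lift

variable {X E : Type*} [TopologicalSpace X] [TopologicalSpace E] {P : E → X}

/-- A class of paths has a lift with given end points. -/
def LiftsTo (hP : Continuous P) {x x' : X} (q : Path.Homotopic.Quotient x x') (e e' : E) : Prop :=
  ∃ (he : P e = x) (he' : P e' = x') (Γ : Path e e'),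
    q = (Path.Homotopic.Quotient.mk (Γ.map hP)).cast he.symm he'.symm

namespace LiftsTo

variable {hP : Continuous P} {x x' x'' : X} {q : Path.Homotopic.Quotient x x'}
  {q' : Path.Homotopic.Quotient x' x''} {e e' e'' : E}

theorem trans (h : LiftsTo hP q e e') (h' : LiftsTo hP q' e' e'') : LiftsTo hP (q.trans q') e e'' := by
  obtain ⟨rfl, rfl, Γ, rfl⟩ := h
  obtain ⟨-, rfl, Γ', rfl⟩ := h'
  refine ⟨rfl, rfl, Γ.trans Γ', ?_⟩
  simp only [Path.Homotopic.Quotient.cast_rfl_rfl, Path.map_trans, Path.Homotopic.Quotient.mk_trans]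

theorem symm (h : LiftsTo hP q e e') : LiftsTo hP q.symm e' e := by
  obtain ⟨rfl, rfl, Γ, rfl⟩ := h
  refine ⟨rfl, rfl, Γ.symm, ?_⟩
  simp only [Path.Homotopic.Quotient.cast_rfl_rfl]
  rfl

theorem of_path (Γ : Path e e') {γ : Path x x'} (h : ∀ t, P (Γ t) = γ t) :
    LiftsTo hP (.mk γ) e e' := by
  obtain rfl : P e = x := by simpa using h 0
  obtain rfl : P e' = x' := by simpa using h 1
  refine ⟨rfl, rfl, Γ, ?_⟩
  rw [Path.Homotopic.Quotient.cast_rfl_rfl]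
  exact congrArg Path.Homotopic.Quotient.mk (Path.ext (funext fun t => (h t).symm))

theorem exists_of_isCoveringMap (hcov : IsCoveringMap P) (q : Path.Homotopic.Quotient x x')
    (he : P e = x) : ∃ e' : E, LiftsTo hcov.continuous q e e' := by
  subst he
  induction q using Path.Homotopic.Quotient.ind with | _ γ => ?_
  have hl : P ∘ hcov.liftPath γ e γ.source = γ := hcov.liftPath_lifts _ _ _
  exact ⟨hcov.liftPath γ e γ.source 1, .of_path
    ⟨hcov.liftPath γ e γ.source, hcov.liftPath_zero _ _ _, rfl⟩ (congrFun hl)⟩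

/-- Homotopic paths lifted from a common point have a common end point. -/
theorem end_unique (hcov : IsCoveringMap P) (h : LiftsTo hcov.continuous q e e')
    (h' : LiftsTo hcov.continuous q e e'') : e' = e'' := by
  obtain ⟨rfl, rfl, Γ, rfl⟩ := h
  obtain ⟨_, he, Γ', h⟩ := h'
  have key : ∀ {e₁ : E} (Γ₁ : Path e e₁), Γ₁ = hcov.liftPath (Γ₁.map hcov.continuous) e
      (Γ₁.map hcov.continuous).source := fun Γ₁ => (hcov.eq_liftPath_iff' _).2 ⟨rfl, Γ₁.source⟩
  have h2 : (Γ.map hcov.continuous).Homotopic ((Γ'.map hcov.continuous).cast rfl he.symm) :=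
    Path.Homotopic.Quotient.eq.1 h
  have h1 := hcov.liftPath_apply_one_eq_of_homotopicRel h2 e (Γ.map hcov.continuous).source
    (Γ'.map hcov.continuous).source
  rw [← Γ.target, ← Γ'.target]
  exact (congrArg (fun f : C(I, E) => f 1) (key Γ)).trans
    (h1.trans (congrArg (fun f : C(I, E) => f 1) (key Γ')).symm)

theorem liftProj_eq [LocallyPathConnectedSpace X] (hU : IsUniversalCover P) {γ : Path x x'}
    (h : LiftsTo hU.isCoveringMap.continuous (.mk γ) e e') :
    liftProj hU γ = Quotient.mk (diagonalOrbit P) (e, e') := by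
  have hcov := hU.isCoveringMap
  obtain ⟨rfl, -, -⟩ := id h
  have hl : P ∘ hcov.liftPath γ e γ.source = γ := hcov.liftPath_lifts _ _ _
  have h1 := end_unique hcov h (.of_path ⟨hcov.liftPath γ e γ.source, hcov.liftPath_zero _ _ _, rfl⟩
    (congrFun hl))
  rw [TopComplexity.liftProj_eq hU γ (hcov.liftPath γ e γ.source) (congrFun hl), h1,
    hcov.liftPath_zero]
  rfl

end LiftsTo

variable [LocallyPathConnectedSpace X]

/-- Over an open set on which the coordinates of loops are conjugate, the projection of the
balanced product has a continuous section. -/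
theorem IsConjugateOn.exists_balanced (hP : IsUniversalCover P) {U : Set (X × X)} (hU : IsOpen U)
    (h : IsConjugateOn U) :
    ∃ l : C(U, BalancedProduct P), ∀ u, balancedProj P (l u) = u := by
  obtain ⟨C, hC⟩ := h.exists_horizontal
  have hcov := hP.isCoveringMap
  have : LocallyPathConnectedSpace U := hU.locallyPathConnectedSpace
  let l : U → BalancedProduct P := fun u => liftProj hP (C u).out
  refine ⟨⟨l, continuous_iff_continuousAt.2 fun u => ?_⟩, fun u => ?_⟩
  swap
  · exact (balancedProj_liftProj hP _).trans (Prod.ext (C u).out.source (C u).out.target)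
  obtain ⟨e, he⟩ := hP.surjective (fstOn U u)
  obtain ⟨e', hL⟩ := LiftsTo.exists_of_isCoveringMap hcov (C u) he
  have he' : P e' = sndOn U u := hL.2.1
  obtain ⟨φ, hφe, hφ⟩ := hcov.isLocalHomeomorph e
  obtain ⟨ψ, hψe, hψ⟩ := hcov.isLocalHomeomorph e'
  have hu1 : fstOn U u ∈ φ.target := by rw [← he, hφ]; exact φ.map_source hφe
  have hu2 : sndOn U u ∈ ψ.target := by rw [← he', hψ]; exact ψ.map_source hψe
  have hN : (fstOn U ⁻¹' φ.target ∩ sndOn U ⁻¹' ψ.target) ∈ 𝓝 u :=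
    ((φ.open_target.preimage (fstOn U).continuous).inter
      (ψ.open_target.preimage (sndOn U).continuous)).mem_nhds ⟨hu1, hu2⟩
  obtain ⟨N, ⟨huN, hNp⟩, hNs⟩ := (path_connected_basis u).mem_iff.1 hN
  -- For `w` near `u`, horizontality writes `C w` as `ζ₁⁻¹ · C u · ζ₂` with short paths `ζ₁`, `ζ₂`.
  -- These lift within the sheets `φ` and `ψ`, which identifies both end points of a lift of `C w`.
  have key : ∀ w ∈ N, Quotient.mk (diagonalOrbit P) (φ.symm (fstOn U w), ψ.symm (sndOn U w)) = l w := by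
    intro w hw
    obtain ⟨ζ, hζ⟩ := hNp.joinedIn u (mem_of_mem_nhds huN) w hw
    have hA : LiftsTo hcov.continuous ((Path.Homotopic.Quotient.mk ζ).map (fstOn U)) e
        (φ.symm (fstOn U w)) := by
      refine LiftsTo.of_path (γ := ζ.map (fstOn U).continuous) ⟨⟨fun t => φ.symm (fstOn U (ζ t)),
        φ.symm.continuousOn.comp_continuous (by fun_prop) fun t => (hNs (hζ t)).1⟩, ?_, ?_⟩ fun t => ?_
      · simp [← he, hφ, φ.left_inv hφe]
      · simp
      · exact (congrFun hφ _).trans (φ.right_inv (hNs (hζ t)).1)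
    have hB : LiftsTo hcov.continuous ((Path.Homotopic.Quotient.mk ζ).map (sndOn U)) e'
        (ψ.symm (sndOn U w)) := by
      refine LiftsTo.of_path (γ := ζ.map (sndOn U).continuous) ⟨⟨fun t => ψ.symm (sndOn U (ζ t)),
        ψ.symm.continuousOn.comp_continuous (by fun_prop) fun t => (hNs (hζ t)).2⟩, ?_, ?_⟩ fun t => ?_
      · simp [← he', hψ, ψ.left_inv hψe]
      · simp
      · exact (congrFun hψ _).trans (ψ.right_inv (hNs (hζ t)).2)
    have hCw : C w = .mk (C w).out := (C w).out_eq.symm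
    have e1 : ((Path.Homotopic.Quotient.mk ζ).map (fstOn U)).symm.trans
        ((C u).trans ((Path.Homotopic.Quotient.mk ζ).map (sndOn U))) = C w := by
      rw [← hC, symm_trans_trans]
    have := hA.symm.trans (hL.trans hB)
    rw [e1, hCw] at this
    exact (this.liftProj_eq hP).symm
  have hcont : ContinuousAt (fun w => Quotient.mk (diagonalOrbit P)
      (φ.symm (fstOn U w), ψ.symm (sndOn U w))) u := by
    refine (isOpenQuotientMap_mk P).continuous.continuousAt.comp (ContinuousAt.prodMk ?_ ?_)
    · exact (φ.symm.continuousAt hu1).comp (f := fstOn U) (fstOn U).continuous.continuousAt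
    · exact (ψ.symm.continuousAt hu2).comp (f := sndOn U) (sndOn U).continuous.continuousAt
  exact hcont.congr (Filter.mem_of_superset huN key)

end Lift

end TopComplexity

/-! ### The invariants of a product with a simply connected factor -/

namespace TopComplexity

open HomotopyClass

theorem IsConjugateOn.preimage_prodMk {X Y : Type*} [TopologicalSpace X] [TopologicalSpace Y] (y : Y)
    {U : Set ((X × Y) × (X × Y))} (h : IsConjugateOn U) :
    IsConjugateOn ((fun z : X × X => ((z.1, y), (z.2, y))) ⁻¹' U) := by
  set V := (fun z : X × X => ((z.1, y), (z.2, y))) ⁻¹' U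
  let F : C(V, U) := ⟨fun v => ⟨((v.1.1, y), (v.1.2, y)), v.2⟩, by fun_prop⟩
  let p : C(X × Y, X) := ⟨Prod.fst, continuous_fst⟩
  intro v
  obtain ⟨c, hc⟩ := h (F v)
  refine ⟨c.map p, fun a => ?_⟩
  have h1 := congrArg (fun q => Path.Homotopic.Quotient.map q p) (hc (a.map F))
  simp only [map_trans] at h1
  induction a using Path.Homotopic.Quotient.ind with | _ a => ?_
  exact h1

theorem TCD_prod_le {X Y : Type*} [TopologicalSpace X] [TopologicalSpace Y]
    [SimplyConnectedSpace Y] (z₀ : X × Y) : TCD z₀ ≤ TC X :=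
  minCover_le_of_preimage (f := fun z : (X × Y) × (X × Y) => (z.1.1, z.2.1)) (by fun_prop)
    fun _ _ h => (isConjugateOn_of_section h).isDiagonalOn

/-- Restrict to the slice at `z₀.2`. There the diagonal condition gives a section of `balancedProj`,
and the global section `s` converts it into a motion planner. -/
theorem le_TCD_prod {X Y E : Type*} [TopologicalSpace X] [TopologicalSpace Y] [TopologicalSpace E]
    [PathConnectedSpace X] [LocallyPathConnectedSpace X] [PathConnectedSpace Y] {P : E → X}
    (hP : IsUniversalCover P) (s : C(BalancedProduct P, C(I, X))) (hs : ∀ b, liftProj hP (s b) = b)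
    (z₀ : X × Y) : TC X ≤ TCD z₀ := by
  refine minCover_le_of_preimage (f := fun z : X × X => ((z.1, z₀.2), (z.2, z₀.2))) (by fun_prop)
    fun U hU h => ?_
  obtain ⟨l, hl⟩ := (h.isConjugateOn.preimage_prodMk z₀.2).exists_balanced hP (hU.preimage (by fun_prop))
  refine ⟨s.comp l, fun u => ?_⟩
  change (s (l u) 0, s (l u) 1) = _
  rw [← balancedProj_liftProj hP, hs, hl]

/-- The slice `{x} × Y` lifts to the cover because `Y` is simply connected, so pairs of points of
`Y` map continuously to the balanced product. -/
theorem le_TCTilde_prod {X Y E : Type*} [TopologicalSpace X] [TopologicalSpace Y] [TopologicalSpace E]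
    [LocallyPathConnectedSpace X] [LocallyPathConnectedSpace Y] [SimplyConnectedSpace Y]
    [Nonempty X] {P : E → X × Y} (hP : IsUniversalCover P) : TC Y ≤ TCTilde hP := by
  obtain ⟨x⟩ := ‹Nonempty X›
  obtain ⟨y⟩ : Nonempty Y := inferInstance
  obtain ⟨e, he⟩ := hP.surjective (x, y)
  obtain ⟨j, ⟨-, hj⟩, -⟩ := hP.isCoveringMap.existsUnique_continuousMap_lifts
    (⟨fun y => (x, y), by fun_prop⟩ : C(Y, X × Y)) y e he
  rw [TC, TCTilde, secat, secatTilde]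
  refine minCover_le_of_preimage (f := fun z : Y × Y => ((x, z.1), (x, z.2))) (by fun_prop)
    fun U hU ⟨s, hs⟩ => ?_
  set V := (fun z : Y × Y => ((x, z.1), (x, z.2))) ⁻¹' U
  have hb : ∀ z : Y × Y, balancedProj P (Quotient.mk _ (j z.1, j z.2)) = ((x, z.1), (x, z.2)) :=
    fun z => Prod.ext (congrFun hj z.1) (congrFun hj z.2)
  have hm : ∀ z : V, Quotient.mk (diagonalOrbit P) (j z.1.1, j z.1.2) ∈ balancedProj P ⁻¹' U :=
    fun z => by rw [Set.mem_preimage, hb]; exact z.2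
  let m : C(V, balancedProj P ⁻¹' U) := ⟨fun z => ⟨_, hm z⟩,
    (continuous_quotient_mk'.comp (f := fun z : V => (j z.1.1, j z.1.2)) (by fun_prop)).subtype_mk hm⟩
  let p : C(X × Y, Y) := ⟨Prod.snd, continuous_snd⟩
  refine ⟨(⟨_, ContinuousMap.continuous_postcomp p⟩ : C(C(I, X × Y), C(I, Y))).comp (s.comp m),
    fun z => ?_⟩
  have h := (balancedProj_liftProj hP (s (m z))).symm.trans
    ((congrArg (balancedProj P) (hs (m z))).trans (hb z))
  exact Prod.ext (congrArg (fun w => w.1.2) h) (congrArg (fun w => w.2.2) h)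

theorem locallyPathConnectedSpace_of_isCoveringMap {E Z : Type*} [TopologicalSpace E]
    [TopologicalSpace Z] [LocallyPathConnectedSpace Z] {P : E → Z} (hP : IsCoveringMap P) :
    LocallyPathConnectedSpace E := by
  choose φ hφ hφP using hP.isLocalHomeomorph
  let _ : ChartedSpace Z E :=
    { atlas := Set.range φ
      chartAt := φ
      mem_chart_source := hφ
      chart_mem_atlas := Set.mem_range_self }
  exact ChartedSpace.locallyPathConnectedSpace Z E

section Product

variable {X Y E E' : Type*} [TopologicalSpace X] [TopologicalSpace Y] [TopologicalSpace E]
  [TopologicalSpace E'] {P : E → X × Y} {Q : E' → X}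

theorem exists_map_cover [LocallyPathConnectedSpace X] [LocallyPathConnectedSpace Y]
    (hP : IsUniversalCover P) (hQ : IsUniversalCover Q) :
    ∃ Θ : C(E, E'), ∀ e, Q (Θ e) = (P e).1 := by
  have := hP.simplyConnected
  have := locallyPathConnectedSpace_of_isCoveringMap hP.isCoveringMap
  obtain ⟨e⟩ : Nonempty E := inferInstance
  obtain ⟨e', he'⟩ := hQ.surjective (P e).1
  obtain ⟨Θ, ⟨-, h⟩, -⟩ := hQ.isCoveringMap.existsUnique_continuousMap_lifts
    (⟨fun e => (P e).1, continuous_fst.comp hP.isCoveringMap.continuous⟩ : C(E, X)) e e' he'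
  exact ⟨Θ, congrFun h⟩

/-- A path from `e` to `e'` projects to a loop in `X × Y`. Its `X`-coordinate is the image of a loop
in the simply connected `E'`, and its `Y`-coordinate is null-homotopic as well. The lift of a
trivial class is closed. -/
theorem map_cover_injective [SimplyConnectedSpace Y] (hP : IsUniversalCover P) (hQ : IsUniversalCover Q) {Θ : C(E, E')}
    (hΘ : ∀ e, Q (Θ e) = (P e).1) {e e' : E} (h : Θ e = Θ e') (hPe : P e = P e') : e = e' := by
  have := hP.simplyConnected
  let ω : Path e e' := PathConnectedSpace.somePath e e'
  have hcov := hP.isCoveringMap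
  have h1 : LiftsTo hcov.continuous (.mk ((ω.map hcov.continuous).cast rfl hPe)) e e' :=
    .of_path ω fun _ => rfl
  have h2 : LiftsTo hcov.continuous (.mk (Path.refl (P e))) e e :=
    .of_path (Path.refl e) fun _ => rfl
  have h3 : Path.Homotopic.Quotient.mk ((ω.map hcov.continuous).cast rfl hPe) =
      .mk (Path.refl (P e)) := by
    refine prod_ext ?_ (Path.Homotopic.Quotient.eq.2 (SimplyConnectedSpace.paths_homotopic _ _))
    have := hQ.simplyConnected
    have h4 : ((ω.map Θ.continuous).cast rfl h).Homotopic (Path.refl (Θ e)) :=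
      SimplyConnectedSpace.paths_homotopic _ _
    have h5 := Path.Homotopic.Quotient.eq.2
      ((h4.map ⟨Q, hQ.isCoveringMap.continuous⟩).pathCast (hΘ e).symm (hΘ e).symm)
    exact (congrArg Path.Homotopic.Quotient.mk (Path.ext (funext fun r => (hΘ (ω r)).symm))).trans
      (h5.trans (congrArg Path.Homotopic.Quotient.mk (Path.ext (funext fun _ => hΘ e))))
  rw [h3] at h1
  exact h2.end_unique hcov h1

/-- `Θ` intertwines deck transformations and so descends to balanced products. The global section
over `X` then leaves only the `Y`-coordinate to be planned. -/
theorem TCTilde_prod_le [LocallyPathConnectedSpace X] [LocallyPathConnectedSpace Y]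
    [SimplyConnectedSpace Y] (hP : IsUniversalCover P) (hQ : IsUniversalCover Q)
    (s : C(BalancedProduct Q, C(I, X))) (hs : ∀ b, liftProj hQ (s b) = b) : TCTilde hP ≤ TC Y := by
  obtain ⟨Θ, hΘ⟩ := exists_map_cover hP hQ
  have := hP.simplyConnected
  have hcovP := hP.isCoveringMap
  have hcovQ := hQ.isCoveringMap
  have hdeck : ∀ a b : E × E, diagonalOrbit P a b →
      Quotient.mk (diagonalOrbit Q) (Θ a.1, Θ a.2) = Quotient.mk (diagonalOrbit Q) (Θ b.1, Θ b.2) := by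
    rintro ⟨a, a'⟩ _ ⟨g, hg, rfl⟩
    have h1 : Q (Θ a) = Q (Θ (g a)) := by rw [hΘ, hΘ, hg]
    obtain ⟨h, hh, hha⟩ := exists_deck hQ h1
    have h2 := congrFun (hcovQ.eq_of_comp_eq (h.continuous.comp Θ.continuous)
      (Θ.continuous.comp g.continuous) (funext fun x => by
        change Q (h (Θ x)) = Q (Θ (g x))
        rw [hh, hΘ, hΘ, hg]) a hha)
    exact Quotient.sound ⟨h, hh, Prod.ext hha (h2 a')⟩
  let Θ' : C(BalancedProduct P, BalancedProduct Q) := ⟨Quotient.lift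
    (fun a => Quotient.mk (diagonalOrbit Q) (Θ a.1, Θ a.2)) hdeck,
    continuous_quot_lift _ (continuous_quotient_mk'.comp (by fun_prop))⟩
  let f : (X × Y) × (X × Y) → Y × Y := fun z => (z.1.2, z.2.2)
  rw [TC, TCTilde, secat, secatTilde]
  refine minCover_le_of_preimage (f := f) (by fun_prop) fun U hU ⟨t, ht⟩ => ?_
  let W := balancedProj P ⁻¹' (f ⁻¹' U)
  let k : C(W, U) := ⟨fun b => ⟨f (balancedProj P b), b.2⟩, ((by fun_prop : Continuous f).comp
    ((continuous_balancedProj hcovP.continuous).comp continuous_subtype_val)).subtype_mk _⟩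
  let σX : C(W, C(I, X)) := s.comp (Θ'.comp ⟨Subtype.val, continuous_subtype_val⟩)
  let σY : C(W, C(I, Y)) := t.comp k
  refine ⟨(σX.uncurry.prodMk σY.uncurry).curry, fun ⟨b, hb⟩ => ?_⟩
  set γ : C(I, X × Y) := (σX.uncurry.prodMk σY.uncurry).curry ⟨b, hb⟩ with hγ
  have hγt : ∀ r, γ r = (σX ⟨b, hb⟩ r, σY ⟨b, hb⟩ r) := fun r => rfl
  induction b using Quotient.inductionOn with | _ z => ?_
  obtain ⟨e, e'⟩ := z
  have hX := hs (Quotient.mk _ (Θ e, Θ e'))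
  have hX' := balancedProj_liftProj hQ (s (Quotient.mk _ (Θ e, Θ e')))
  rw [hX] at hX'
  have hY := ht (k ⟨_, hb⟩)
  have h0 : γ 0 = P e := Prod.ext ((congrArg Prod.fst hX').symm.trans (hΘ e))
    (congrArg (fun w : Y × Y => w.1) hY)
  have h1 : γ 1 = P e' := Prod.ext ((congrArg Prod.snd hX').symm.trans (hΘ e'))
    (congrArg (fun w : Y × Y => w.2) hY)
  have hl := congrFun (hcovP.liftPath_lifts γ e h0)
  have hl0 := hcovP.liftPath_zero γ e h0
  set Γ := hcovP.liftPath γ e h0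
  rw [liftProj_eq hP γ Γ hl, hl0]
  have hΓ := liftProj_eq hQ (s (Quotient.mk _ (Θ e, Θ e'))) (Θ.comp Γ) fun r =>
    (hΘ (Γ r)).trans (congrArg Prod.fst (hl r))
  rw [hX] at hΓ
  obtain ⟨g, hg, hge⟩ := Quotient.exact hΓ
  -- Two representatives of one class with the same first entry coincide, so `Θ ∘ Γ` ends at `Θ e'`;
  -- injectivity over `X × Y` then gives `Γ 1 = e'`.
  have hg1 : g = 1 := deck_eq hQ hg (deckGroup Q).one_mem (e := Θ e)
    ((congrArg Prod.fst hge).trans (congrArg Θ hl0))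
  have h2 : Θ e' = Θ (Γ 1) := by
    have := congrArg Prod.snd hge
    rw [hg1] at this
    exact this
  exact congrArg (fun a => Quotient.mk (diagonalOrbit P) (e, a))
    (map_cover_injective hP hQ hΘ h2 (h1.symm.trans (hl 1).symm)).symm

end Product

/-- The product inequality for topological complexity. -/
theorem TC_prod_le {X Y : Type*} [TopologicalSpace X] [TopologicalSpace Y]
    [Nonempty (X × Y)] [NormalSpace ((X × Y) × (X × Y))] : TC (X × Y) ≤ TC X + TC Y := by
  have : Nonempty C(I, X × Y) := ‹Nonempty (X × Y)›.map (.const I)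
  -- Planning is split by coordinate over the same base: planners for the two coordinates restrict
  -- to smaller sets and combine into one for the product.
  let A₁ : Set ((X × Y) × (X × Y)) → Prop := fun S =>
    ∃ s : C(S, C(I, X)), ∀ z : S, s z 0 = z.1.1.1 ∧ s z 1 = z.1.2.1
  let A₂ : Set ((X × Y) × (X × Y)) → Prop := fun S =>
    ∃ s : C(S, C(I, Y)), ∀ z : S, s z 0 = z.1.1.2 ∧ s z 1 = z.1.2.2
  have h1 : minCover _ A₁ ≤ TC X := minCover_le_of_preimage
    (f := fun z : (X × Y) × (X × Y) => (z.1.1, z.2.1)) (by fun_prop) fun U _ ⟨s, hs⟩ =>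
      ⟨s.comp ⟨fun z => ⟨(z.1.1.1, z.1.2.1), z.2⟩, by fun_prop⟩, fun z =>
        ⟨congrArg Prod.fst (hs _), congrArg Prod.snd (hs _)⟩⟩
  have h2 : minCover _ A₂ ≤ TC Y := minCover_le_of_preimage
    (f := fun z : (X × Y) × (X × Y) => (z.1.2, z.2.2)) (by fun_prop) fun U _ ⟨s, hs⟩ =>
      ⟨s.comp ⟨fun z => ⟨(z.1.1.2, z.1.2.2), z.2⟩, by fun_prop⟩, fun z =>
        ⟨congrArg Prod.fst (hs _), congrArg Prod.snd (hs _)⟩⟩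
  refine le_trans (minCover_le_add (A₁ := A₁) (A₂ := A₂) ?_ ?_) (add_le_add h1 h2)
  · rintro U V W - hU hV ⟨s, hs⟩ ⟨t, ht⟩
    let i : C(W, U) := ⟨Set.inclusion hU, continuous_inclusion hU⟩
    let j : C(W, V) := ⟨Set.inclusion hV, continuous_inclusion hV⟩
    refine ⟨((s.comp i).uncurry.prodMk (t.comp j).uncurry).curry, fun z => ?_⟩
    exact Prod.ext (Prod.ext (hs (i z)).1 (ht (j z)).1) (Prod.ext (hs (i z)).2 (ht (j z)).2)
  · exact fun κ W hW hd h => HasSectionOver.iUnion hW hd h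

end TopComplexity

open TopComplexity in
theorem mainTheorem9 {X : Type*} [TopologicalSpace X] [T2Space X]
    [Topology.CWComplex (Set.univ : Set X)] (hX : IsAspherical X)
    {Y : Type*} [TopologicalSpace Y] [SimplyConnectedSpace Y] (z₀ : X × Y) :
    TCD z₀ = TC X ∧
    ∀ [LocallyPathConnectedSpace Y] {E : Type*} [TopologicalSpace E] {P : E → X × Y}
      (hP : IsUniversalCover P),
      TCTilde hP = TC Y ∧
      TCD z₀ + TCTilde hP = TC X + TC Y ∧
      (NormalSpace ((X × Y) × (X × Y)) → TC (X × Y) ≤ TCD z₀ + TCTilde hP) := by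
  have := hX.pathConnected
  let c := CellStructure.ofCWComplex X
  have := c.locallyPathConnectedSpace
  obtain ⟨E', _, Q, hQ⟩ := c.exists_universalCover
  obtain ⟨e, -⟩ := hQ.surjective z₀.1
  obtain ⟨S, hS, hS1⟩ := exists_contracting_paths hX c hQ e
  obtain ⟨s, hs⟩ := exists_section_liftProj c hQ hS (fun x => (hS1 x).1) fun x => (hS1 x).2
  have hD : TCD z₀ = TC X := le_antisymm (TCD_prod_le z₀) (le_TCD_prod hQ s hs z₀)
  refine ⟨hD, fun {_} {E} _ {P} hP => ?_⟩
  have hT : TCTilde hP = TC Y := le_antisymm (TCTilde_prod_le hP hQ s hs) (le_TCTilde_prod hP)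
  have : Nonempty (X × Y) := ⟨z₀⟩
  exact ⟨hT, by rw [hD, hT], fun _ => by rw [hD, hT]; exact TC_prod_le⟩
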